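/- Let $X^\bullet\colon\Delta\to\mathrm{Top}$ be a cosimplicial space which is fibrant, i.e. for every $n\ge 0$ the matching map $X^{[n+1]}\to M^nX^\bullet$, $x\mapsto(s^0x,\dots,s^nx)$, is a Serre fibration, where $M^nX^\bullet\subseteq (X^{[n]})^{n+1}$ is the space of tuples $(x_0,\dots,x_n)$ with $s^ix_{k+1}=s^kx_i$ for all $0\le i\le k\le n-1$. Let $\operatorname{Tot}^n X^\bullet$ be the space of cosimplicial maps $\Delta^\bullet\to X^\bullet$ truncated to degrees $\le n$. Let $j\ge 1$, let $f=(f_0,\dots,f_{j-1})\in\operatorname{Tot}^{j-1}X^\bullet$ be a chosen base point, and let $$L_jX^\bullet=\operatorname{hofiber}\bigl(\operatorname{Tot}^jX^\bullet\to\operatorname{Tot}^{j-1}X^\bullet\bigr)$$ be the homotopy fiber over $f$, assumed nonempty. Let $c^!_j\colon\mathcal P(\{1,\dots,j\})\to\Delta$ be the functor on the poset of all subsets of $\{1,\dots,j\}$ with $c^!_j(S)=[j-|S|]$ which sends $S\subseteq S'$ to the composite $[j-|S|]\cong\{0,\dots,j\}\setminus S\to\{0,\dots,j\}\setminus S'\cong[j-|S'|]$,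 whose outer maps are the isomorphisms of ordered sets and whose middle map sends $i$ to the largest element of $\{0,\dots,j\}\setminus S'$ that is $\le i$. The cube $X^\bullet\circ c^!_j$ is based by the images of $f_0(\Delta^0)\in X^{[0]}$ under the maps $[0]\to[j-|S|]$, $0\mapsto 0$. For a cube $\mathcal X$ of based spaces, $\operatorname{tfiber}(\mathcal X)$ denotes the total homotopy fiber, i.e. the homotopy fiber of $\mathcal X(\emptyset)\to\operatorname{holim}_{S\ne\emptyset}\mathcal X(S)$ over the base point, itself based in the canonical way. Then $L_jX^\bullet$ and the $j$-fold loop space $\Omega^j\operatorname{tfiber}(X^\bullet\circ c^!_j)$ are equivalent, i.e. joined by a finite zigzag of weak homotopy equivalences: $$L_jX^\bullet\simeq\Omega^j\operatorname{tfiber}(X^\bullet\circ c^!_j).$$ -/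

import Mathlib

open CategoryTheory
open scoped unitInterval

universe u

noncomputable section

namespace TotLayer

/-! ### Weak homotopy equivalences and Serre fibrations -/

section Homotopy

variable {A B : Type u} [TopologicalSpace A] [TopologicalSpace B]

/-- The map induced on path components. -/
def pi0Map (f : C(A, B)) : ZerothHomotopy A → ZerothHomotopy B :=
  Quotient.map f fun _ _ h => h.map f.continuous

/-- Composition of an `n`-dimensional generalized loop with a map. -/
def genLoopMap (f : C(A, B)) (n : ℕ) (a : A) (p : GenLoop (Fin n) A a) :
    GenLoop (Fin n) B (f a) :=
  ⟨f.comp p.1, fun y hy => congrArg f (p.2 y hy)⟩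

/-- The map induced on the `n`-th homotopy group. -/
def piMap (f : C(A, B)) (n : ℕ) (a : A) :
    HomotopyGroup.Pi n A a → HomotopyGroup.Pi n B (f a) :=
  Quotient.map (genLoopMap f n a) fun _ _ h =>
    ContinuousMap.HomotopicRel.comp_continuousMap h f

/-- `f` induces bijections on path components and on all homotopy groups at all base points. -/
def IsWeakHomotopyEquiv (f : C(A, B)) : Prop :=
  Function.Bijective (pi0Map f) ∧
    ∀ (n : ℕ), 1 ≤ n → ∀ a : A, Function.Bijective (piMap f n a)

/-- The homotopy lifting property with respect to all cubes `I^n`, `n ≥ 0`. -/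
def IsSerreFibration (p : C(A, B)) : Prop :=
  ∀ (n : ℕ) (H : C((Fin n → I) × I, B)) (g : C(Fin n → I, A)),
    (∀ x, p (g x) = H (x, 0)) →
      ∃ G : C((Fin n → I) × I, A), (∀ x, G (x, 0) = g x) ∧ ∀ z, p (G z) = H z

/-- The homotopy fiber of `g` over `b`: points `a` with a path from `g a` to `b`. -/
abbrev Hofiber (g : C(A, B)) (b : B) : Type u :=
  {z : A × C(I, B) // z.2 0 = g z.1 ∧ z.2 1 = b}

/-- The canonical base point of the homotopy fiber of `g` over `g a`. -/
def Hofiber.base (g : C(A, B)) (a : A) : Hofiber g (g a) :=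
  ⟨(a, ContinuousMap.const I (g a)), rfl, rfl⟩

end Homotopy

/-- Two spaces are equivalent if a finite zigzag of weak homotopy equivalences joins them. -/
def WeaklyEquivalent (A B : Type u) [TopologicalSpace A] [TopologicalSpace B] : Prop :=
  Relation.EqvGen (fun U V : TopCat.{u} => ∃ f : C(U, V), IsWeakHomotopyEquiv f)
    (TopCat.of A) (TopCat.of B)

/-! ### Homotopy limits over finite posets, cubes and their total homotopy fibers -/

section Holim

variable {P : Type} [PartialOrder P] [Fintype P]

/-- The realization of the nerve of the poset `{p | p ≤ c}`, as a subspace of the simplex on `P`: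
points with barycentric coordinates supported on a chain of elements `≤ c`. -/
abbrev NerveBelow (c : P) : Type :=
  {w : stdSimplex ℝ P // IsChain (· ≤ ·) {p | w p ≠ 0} ∧ ∀ p, w p ≠ 0 → p ≤ c}

/-- The inclusion of nerves for `c ≤ d`. -/
def NerveBelow.incl {c d : P} (h : c ≤ d) (w : NerveBelow c) : NerveBelow d :=
  ⟨w.1, w.2.1, fun p hp => (w.2.2 p hp).trans h⟩

/-- The (Bousfield--Kan) homotopy limit of a diagram of spaces indexed by a finite poset: the space
of natural families of maps from the nerves of `{p | p ≤ c}` to the spaces `F c`. -/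
abbrev Holim (F : P ⥤ TopCat.{u}) : Type u :=
  {φ : ∀ c : P, C(NerveBelow c, F.obj c) //
    ∀ (c d : P) (h : c ≤ d) (w : NerveBelow c),
      φ d (NerveBelow.incl h w) = F.map (homOfLE h) (φ c w)}

end Holim

section Cube

variable {T : Type} [Fintype T] [DecidableEq T]

/-- The restriction of a cube to the nonempty subsets of `T`. -/
def subcube (F : Finset T ⥤ TopCat.{u}) : {S : Finset T // S.Nonempty} ⥤ TopCat.{u} where
  obj S := F.obj S.1
  map {S S'} g := F.map (homOfLE (show S.1 ≤ S'.1 from leOfHom g))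
  map_id S := F.map_id S.1
  map_comp _ _ := F.map_comp _ _

/-- The canonical map from the initial space of a cube to the homotopy limit of the others. -/
def cubeMap (F : Finset T ⥤ TopCat.{u}) : C(F.obj ∅, Holim (subcube F)) where
  toFun x := ⟨fun S => ContinuousMap.const _ (F.map (homOfLE (Finset.empty_subset S.1)) x), by
    intro S S' h w
    change F.map (homOfLE _) x = F.map (homOfLE _) (F.map (homOfLE _) x)
    rw [← ConcreteCategory.comp_apply, ← F.map_comp, homOfLE_comp]⟩
  continuous_toFun := by
    refine Continuous.subtype_mk (continuous_pi fun S => ?_) _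
    exact ContinuousMap.continuous_const'.comp (F.map _).hom.continuous

/-- The total homotopy fiber of a cube of based spaces. As `∅` is initial, base points compatible
with all maps of the cube amount to one base point `b` of `F ∅`. -/
abbrev Tfiber (F : Finset T ⥤ TopCat.{u}) (b : F.obj ∅) : Type u :=
  Hofiber (cubeMap F) (cubeMap F b)

/-- The base point of the total homotopy fiber. -/
def Tfiber.base (F : Finset T ⥤ TopCat.{u}) (b : F.obj ∅) : Tfiber F b :=
  Hofiber.base (cubeMap F) b

end Cube

/-! ### Cosimplicial spaces: fibrancy and partial totalizations -/

/-- The matching space `M^n X`, receiving the codegeneracies out of `X^{[n+1]}`: families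
`(x_0, …, x_n)` in `X^{[n]}` with `s^i x_{j+1} = s^j x_i` for `i ≤ j`. -/
def matchingSet (X : CosimplicialObject TopCat.{u}) :
    (n : ℕ) → Set (Fin (n + 1) → X.obj (SimplexCategory.mk n))
  | 0 => Set.univ
  | _ + 1 => {x | ∀ i j, i ≤ j → X.σ i (x j.succ) = X.σ j (x i.castSucc)}

/-- The matching map `x ↦ (s^0 x, …, s^n x)`. -/
def matchingMap (X : CosimplicialObject TopCat.{u}) (n : ℕ) :
    C(X.obj (SimplexCategory.mk (n + 1)), matchingSet X n) where
  toFun x := ⟨fun i => X.σ i x, by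
    cases n with
    | zero => trivial
    | succ m =>
      intro i j h
      have e := X.σ_comp_σ h
      exact (ConcreteCategory.congr_hom e x).symm⟩
  continuous_toFun :=
    Continuous.subtype_mk (continuous_pi fun i => (X.σ i).hom.continuous) _

/-- A cosimplicial space is fibrant if its matching maps are Serre fibrations (the map from
`X^{[0]}` to a point is always one). -/
def IsFibrant (X : CosimplicialObject TopCat.{u}) : Prop :=
  ∀ n : ℕ, IsSerreFibration (matchingMap X n)

/-- `Tot^n X`: the space of cosimplicial maps from the cosimplicial simplex to `X`, both truncated
to degrees `≤ n`. -/
abbrev Tot (X : CosimplicialObject TopCat.{u}) (n : ℕ) : Type u :=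
  {f : ∀ p : Fin (n + 1), C(stdSimplex ℝ (Fin (p.val + 1)), X.obj (SimplexCategory.mk p.val)) //
    ∀ (p q : Fin (n + 1)) (θ : SimplexCategory.mk p.val ⟶ SimplexCategory.mk q.val)
      (t : stdSimplex ℝ (Fin (p.val + 1))),
      f q (stdSimplex.map (fun k : Fin (p.val + 1) => θ.toOrderHom k) t) = X.map θ (f p t)}

/-- The map `Tot^{n+1} X → Tot^n X` forgetting the top degree. -/
def totRestrict (X : CosimplicialObject TopCat.{u}) (n : ℕ) : C(Tot X (n + 1), Tot X n) where
  toFun f := ⟨fun p => f.1 p.castSucc, fun p q θ t => f.2 p.castSucc q.castSucc θ t⟩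
  continuous_toFun :=
    Continuous.subtype_mk
      (continuous_pi fun p => (continuous_apply p.castSucc).comp continuous_subtype_val) _

/-- The layer `L_{n+1} X`: the homotopy fiber of `Tot^{n+1} X → Tot^n X` over `f`. -/
abbrev Layer (X : CosimplicialObject TopCat.{u}) (n : ℕ) (f : Tot X n) : Type u :=
  Hofiber (totRestrict X n) f

/-! ### The functor `c^!_j` -/

section CShriek

variable {j : ℕ}

/-- `[j] - S`, where `k : Fin j` stands for the element `k + 1` of `{1, …, j}`. -/
def remaining (S : Finset (Fin j)) : Finset (Fin (j + 1)) :=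
  (S.map (Fin.succEmb j))ᶜ

theorem zero_mem_remaining (S : Finset (Fin j)) : 0 ∈ remaining S := by
  simp [remaining]

theorem card_remaining (S : Finset (Fin j)) : (remaining S).card = j - S.card + 1 := by
  have h : S.card ≤ j := by simpa using S.card_le_univ
  rw [remaining, Finset.card_compl, Finset.card_map, Fintype.card_fin]
  omega

theorem remaining_anti {S S' : Finset (Fin j)} (h : S ≤ S') : remaining S' ⊆ remaining S :=
  Finset.compl_subset_compl.mpr (Finset.map_subset_map.mpr h)

/-- The isomorphism of ordered sets `[j - |S|] ≅ [j] - S`. -/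
def remainingIso (S : Finset (Fin j)) : Fin (j - S.card + 1) ≃o remaining S :=
  (remaining S).orderIsoOfFin (card_remaining S)

theorem floor_nonempty (S : Finset (Fin j)) (i : Fin (j + 1)) :
    ((remaining S).filter (· ≤ i)).Nonempty :=
  ⟨0, Finset.mem_filter.mpr ⟨zero_mem_remaining S, Fin.zero_le i⟩⟩

/-- The largest element of `[j] - S` less than or equal to `i`. -/
def floor (S : Finset (Fin j)) (i : Fin (j + 1)) : remaining S :=
  ⟨((remaining S).filter (· ≤ i)).max' (floor_nonempty S i),
    (Finset.mem_filter.mp (Finset.max'_mem _ (floor_nonempty S i))).1⟩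

theorem floor_le (S : Finset (Fin j)) (i : Fin (j + 1)) : (floor S i).1 ≤ i :=
  (Finset.mem_filter.mp (Finset.max'_mem _ (floor_nonempty S i))).2

theorem le_floor {S : Finset (Fin j)} {i k : Fin (j + 1)} (hk : k ∈ remaining S) (h : k ≤ i) :
    k ≤ (floor S i).1 :=
  Finset.le_max' _ _ (Finset.mem_filter.mpr ⟨hk, h⟩)

theorem floor_mono (S : Finset (Fin j)) : Monotone (floor S) := fun _ _ h =>
  le_floor (floor S _).2 ((floor_le S _).trans h)

theorem floor_self {S : Finset (Fin j)} (x : remaining S) : floor S x.1 = x :=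
  le_antisymm (floor_le S x.1) (le_floor x.2 le_rfl)

theorem floor_floor {S S' : Finset (Fin j)} (h : S ≤ S') (i : Fin (j + 1)) :
    floor S' (floor S i).1 = floor S' i :=
  le_antisymm (floor_mono S' (floor_le S i))
    (le_floor (floor S' i).2 (le_floor (remaining_anti h (floor S' i).2) (floor_le S' i)))

/-- The functor `c^!_j` from the subsets of `{1, …, j}` to the simplex category, `S ↦ [j - |S|]`.
It sends `S ⊆ S'` to the composite `[j - |S|] ≅ [j] - S → [j] - S' ≅ [j - |S'|]`, whose middle map
sends `i` to the largest element of `[j] - S'` less than or equal to `i`. -/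
def cShriek (j : ℕ) : Finset (Fin j) ⥤ SimplexCategory where
  obj S := SimplexCategory.mk (j - S.card)
  map {S S'} _ := SimplexCategory.mkHom
    ⟨fun k => (remainingIso S').symm (floor S' (remainingIso S k).1),
      fun _ _ h => (remainingIso S').symm.monotone
        (floor_mono S' ((remainingIso S).monotone h))⟩
  map_id S := by
    ext k : 3
    change (remainingIso S).symm (floor S (remainingIso S k).1) = k
    rw [floor_self, OrderIso.symm_apply_apply]
  map_comp {S S' S''} f g := by
    ext k : 3
    change (remainingIso S'').symm (floor S'' (remainingIso S k).1) =
      (remainingIso S'').symm (floor S'' (remainingIso S'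
        ((remainingIso S').symm (floor S' (remainingIso S k).1))).1)
    rw [OrderIso.apply_symm_apply, floor_floor (leOfHom g)]

end CShriek

/-- The `j`-cube of spaces `X ∘ c^!_j`. -/
def shriekCube (X : CosimplicialObject TopCat.{u}) (j : ℕ) : Finset (Fin j) ⥤ TopCat.{u} :=
  cShriek j ⋙ X

/-- The base point of the cube `X ∘ c^!_j` determined by `x ∈ X^{[0]}`: the image of `x` in
`X^{[j]}` under the map `[0] → [j]`, `0 ↦ 0`. -/
def shriekBase (X : CosimplicialObject TopCat.{u}) (j : ℕ) (x : X.obj (SimplexCategory.mk 0)) :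
    (shriekCube X j).obj ∅ :=
  X.map (SimplexCategory.const (SimplexCategory.mk 0) ((cShriek j).obj ∅) 0) x

/-- The point `f_0(Δ^0)` of `X^{[0]}`. -/
def Tot.point {X : CosimplicialObject TopCat.{u}} {n : ℕ} (f : Tot X n) :
    X.obj (SimplexCategory.mk 0) :=
  f.1 0 (stdSimplex.vertex 0)

end TotLayer

end

/-! Let n + 1 be the index of the layer. Extending f in Tot^n to Tot^{n+1} means choosing a map
Δ^{n+1} → X^{[n+1]} that is prescribed on the boundary (by the cofaces) and prescribed after the
matching map (by the codegeneracies). As the matching map is a Serre fibration, so is Tot^{n+1} →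
Tot^n (`IsFibrant.isSerreFibration_totRestrict`), and the layer may be replaced by the strict fiber:
the space of maps on a cube that agree with one fixed extension a on the boundary and over the
matching space (`Fiber.weaklyEquivalent_relSections`). Contracting the cube onto a point y₀ deforms
a to a constant map, and evaluating homotopies at their two ends shows that the section space does
not change up to weak equivalence. For a constant map it is the (n+1)-fold loop space of the fiber
of the matching map (`IsSerreFibration.weaklyEquivalent_relSections`). Taking y₀ over the vertex 0
puts the base point at the image of f_0(Δ^0).

The maps of the cube X ∘ c^! that add one element are codegeneracies. Hence the matching map and the
canonical map of the cube to its homotopy limit have the same fibers (`matchingMap_eq_iff`), and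
fibrancy of X yields at every vertex S a lifting property relative to the vertices above it
(`IsFibrant.exists_box_lift_shriekCube`). For such a cube F the strict total fiber is equivalent to
the total homotopy fiber (`IsFibrantCube.isCompressing_fiberInclusion`): the cone on the nerve of
the nonempty subsets of S is the cube I^S, so a point of the total homotopy fiber is a compatible
family of maps I^S → F S that send the faces z_i = 0 to the base point. Such a family is deformed,
from large S to small, until it is constant at all nonempty S.

All comparison maps are handled by one criterion, `IsCompressing`: a cube in the target whose
boundary lifts can be deformed, relative to the boundary, to a cube that lifts. It implies weak
equivalence and passes to loop spaces (`IsCompressing.loopMap`). The deformations come from lifting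
against boxes (`IsSerreFibration.exists_box_lift`). -/

noncomputable section

namespace TotLayer

/-! ### Lifting boxes against Serre fibrations -/

section Box

variable {A B : Type u} [TopologicalSpace A] [TopologicalSpace B]

/-- The part of the boundary of a cube consisting of both faces in the directions of `D` and of the
initial face in the directions of `E`. -/
def box {N : Type} (D E : Set N) : Set (N → I) :=
  {x | (∃ i ∈ D, x i = 0 ∨ x i = 1) ∨ ∃ i ∈ E, x i = 0}

theorem IsSerreFibration.exists_lift {p : C(A, B)} (hp : IsSerreFibration p) {N K : Type} [Finite N]
    [TopologicalSpace K] (e : K ≃ₜ (N → I)) (H : C(K × I, B)) (g : C(K, A))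
    (h : ∀ x, p (g x) = H (x, 0)) :
    ∃ G : C(K × I, A), (∀ x, G (x, 0) = g x) ∧ ∀ z, p (G z) = H z := by
  obtain ⟨n, ⟨q⟩⟩ := Finite.exists_equiv_fin N
  let e' : K ≃ₜ (Fin n → I) := e.trans (Homeomorph.piCongrLeft (Y := fun _ => I) q)
  obtain ⟨G, h0, h1⟩ := hp n (H.comp ⟨fun z => (e'.symm z.1, z.2), by fun_prop⟩)
    (g.comp ⟨e'.symm, e'.symm.continuous⟩) (fun x => h _)
  refine ⟨G.comp ⟨fun z => (e' z.1, z.2), by fun_prop⟩, fun x => ?_, fun z => ?_⟩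
  · simpa using h0 (e' x)
  · simpa using h1 (e' z.1, z.2)

namespace Box

variable {N : Type} (D E : Set N)

open Classical in
/-- The apex from which a box is projected. -/
def apex (i : N) : ℝ := if i ∈ E then 2 else 1 / 2

open Classical in
/-- The radial flow away from the apex. -/
def flow (x : N → I) (l : ℝ) : N → I := fun i =>
  if i ∈ D ∪ E then Set.projIcc 0 1 zero_le_one (apex E i + l * (x i - apex E i)) else x i

open Classical in
/-- The distance from the apex in the direction `i`. -/
def radius (x : N → I) (i : N) : ℝ :=
  if i ∈ E then 1 - x i / 2 else if i ∈ D then |2 * (x i : ℝ) - 1| else 0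

theorem continuous_flow : Continuous fun z : (N → I) × ℝ => flow D E z.1 z.2 := by
  refine continuous_pi fun i => ?_
  unfold flow
  by_cases h : i ∈ D ∪ E
  · simp only [h, if_true]
    exact continuous_projIcc.comp (by fun_prop)
  · simp only [h, if_false]
    fun_prop

theorem continuous_radius (i : N) : Continuous fun x : N → I => radius D E x i := by
  unfold radius
  split_ifs <;> fun_prop

theorem flow_one (x : N → I) : flow D E x 1 = x := by
  funext i
  unfold flow
  split_ifs
  · simp
  · rfl

theorem radius_le_one (x : N → I) (i : N) : radius D E x i ≤ 1 := by
  have h0 := (x i).2.1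
  have h1 := (x i).2.2
  unfold radius
  split_ifs
  · linarith
  · rw [abs_le]; constructor <;> linarith
  · norm_num

theorem radius_of_mem_box {x : N → I} (hDE : Disjoint D E) (hx : x ∈ box D E) :
    ∃ i, radius D E x i = 1 := by
  obtain ⟨i, hi, h⟩ | ⟨i, hi, h⟩ := hx
  · have : i ∉ E := fun h => hDE.le_bot ⟨hi, h⟩
    refine ⟨i, ?_⟩
    rcases h with h | h <;> norm_num [radius, this, hi, h]
  · exact ⟨i, by simp [radius, hi, h]⟩

/-- The radius is normalized so that scaling by its inverse moves coordinate i exactly onto a face: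
onto 0 when the apex is 2, onto 0 or 1 when the apex is 1/2. -/
theorem flow_mem_box {x : N → I} {l : ℝ} {i : N} (h : l * radius D E x i = 1) :
    flow D E x l ∈ box D E := by
  unfold radius at h
  split_ifs at h with hE hD
  · refine Or.inr ⟨i, hE, ?_⟩
    simp only [flow, apex, hE, Set.mem_union, or_true, if_true]
    apply Set.projIcc_of_le_left
    nlinarith
  · refine Or.inl ⟨i, hD, ?_⟩
    simp only [flow, apex, hE, hD, Set.mem_union, true_or, if_true, if_false]
    rcases abs_cases (2 * (x i : ℝ) - 1) with ⟨h', -⟩ | ⟨h', -⟩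
    · right
      apply Set.projIcc_of_right_le
      rw [h'] at h
      nlinarith
    · left
      apply Set.projIcc_of_le_left
      rw [h'] at h
      nlinarith
  · simp at h

end Box

/-- A Serre fibration has the right lifting property with respect to the inclusions of boxes. -/
theorem IsSerreFibration.exists_box_lift {p : C(A, B)} (hp : IsSerreFibration p) {N K : Type}
    [Finite N] [TopologicalSpace K] (e : K ≃ₜ (N → I)) {D E : Set N} (hDE : Disjoint D E)
    (hE : E.Nonempty) (a : K → A) (ha : ContinuousOn a (e ⁻¹' box D E)) (b : C(K, B))
    (hab : ∀ x, e x ∈ box D E → p (a x) = b x) :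
    ∃ l : C(K, A), (∀ x, e x ∈ box D E → l x = a x) ∧ ∀ x, p (l x) = b x := by
  classical
  have := Fintype.ofFinite N
  have hne : (Finset.univ : Finset N).Nonempty := ⟨hE.some, Finset.mem_univ _⟩
  let m : (N → I) → ℝ := fun x => Finset.univ.sup' hne (Box.radius D E x)
  have hm_cont : Continuous m :=
    Continuous.finset_sup'_apply hne fun i _ => Box.continuous_radius D E i
  have hm_le : ∀ x, m x ≤ 1 := fun x => Finset.sup'_le _ _ fun i _ => Box.radius_le_one D E x i
  -- In a direction of E the apex coordinate is 2 while x i ≤ 1, so the radius is at least 1/2.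
  -- Hence the scale 1/m lies in [1, 2], and the time s used below lies in the unit interval.
  have hm_half : ∀ x, 1 / 2 ≤ m x := fun x => by
    refine le_trans ?_ (Finset.le_sup' (Box.radius D E x) (Finset.mem_univ hE.some))
    have := (x hE.some).2.2
    simp only [Box.radius, hE.some_mem, if_true]
    linarith
  have hm_box : ∀ x ∈ box D E, m x = 1 := fun x hx => by
    obtain ⟨i, hi⟩ := Box.radius_of_mem_box D E hDE hx
    exact le_antisymm (hm_le x) (hi ▸ Finset.le_sup' (Box.radius D E x) (Finset.mem_univ i))
  have hm_pos : ∀ x, 0 < m x := fun x => by linarith [hm_half x]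
  have hm_inv : Continuous fun x => (m x)⁻¹ := hm_cont.inv₀ fun x => (hm_pos x).ne'
  have hinv1 : ∀ x, 1 ≤ (m x)⁻¹ := fun x => (one_le_inv₀ (hm_pos x)).2 (hm_le x)
  have hinv2 : ∀ x, (m x)⁻¹ ≤ 2 := fun x => by
    rw [inv_le_comm₀ (hm_pos x) two_pos]; linarith [hm_half x]
  have hflow : ∀ x, Box.flow D E x (m x)⁻¹ ∈ box D E := fun x => by
    obtain ⟨i, -, hi⟩ := Finset.exists_mem_eq_sup' hne (Box.radius D E x)
    refine Box.flow_mem_box D E (i := i) ?_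
    rw [← hi]
    exact inv_mul_cancel₀ (hm_pos x).ne'
  let r : K → K := fun x => e.symm (Box.flow D E (e x) (m (e x))⁻¹)
  have hr : Continuous r := e.symm.continuous.comp
    ((Box.continuous_flow D E).comp (e.continuous.prodMk (hm_inv.comp e.continuous)))
  have hr_mem : ∀ x, e (r x) ∈ box D E := fun x => by
    simpa only [r, Homeomorph.apply_symm_apply] using hflow (e x)
  let g : C(K, A) := ⟨a ∘ r, ha.comp_continuous hr hr_mem⟩
  -- The scale decreases from 1/m, where the flow is the projection r onto the box and `a ∘ r` is a
  -- lift, and stops at 1, where the flow is the identity. The scale 1 is reached at time s = 1/m -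
  -- 1, so the desired lift is G at time s; on the box s = 0.
  let H : C(K × I, B) :=
    ⟨fun z => b (e.symm (Box.flow D E (e z.1) (max 1 ((m (e z.1))⁻¹ - z.2)))),
      b.continuous.comp (e.symm.continuous.comp ((Box.continuous_flow D E).comp
        ((e.continuous.comp continuous_fst).prodMk (continuous_const.max
          ((hm_inv.comp (e.continuous.comp continuous_fst)).sub (by fun_prop))))))⟩
  obtain ⟨G, hG0, hG⟩ := hp.exists_lift e H g fun x => by
    change p (a (r x)) = b (e.symm (Box.flow D E (e x) (max 1 ((m (e x))⁻¹ - (0 : ℝ)))))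
    rw [hab _ (hr_mem x), sub_zero, max_eq_right (hinv1 _)]
  let s : K → I := fun x => ⟨(m (e x))⁻¹ - 1, by
    have := hinv1 (e x); have := hinv2 (e x); constructor <;> linarith⟩
  have hs : Continuous s :=
    Continuous.subtype_mk ((hm_inv.comp e.continuous).sub continuous_const) _
  refine ⟨G.comp ⟨fun x => (x, s x), by fun_prop⟩, fun x hx => ?_, fun x => ?_⟩
  · have h1 : s x = 0 := Subtype.ext (by simp [s, hm_box _ hx])
    have h2 : r x = x := by simp [r, hm_box _ hx, Box.flow_one]
    change G (x, s x) = a x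
    rw [h1, hG0]
    change a (r x) = a x
    rw [h2]
  · change p (G (x, s x)) = b x
    rw [hG]
    change b (e.symm (Box.flow D E (e x) (max 1 ((m (e x))⁻¹ - ((m (e x))⁻¹ - 1))))) = b x
    rw [sub_sub_cancel, max_self, Box.flow_one, e.symm_apply_apply]

/-- Compatible maps defined on finitely many closed sets can be glued. -/
theorem exists_continuousOn_glue {T Y Z : Type*} [Finite T] [TopologicalSpace Y]
    [TopologicalSpace Z] [Nonempty Z] (C : T → Set Y) (a : T → Y → Z) (hC : ∀ k, IsClosed (C k))
    (ha : ∀ k, ContinuousOn (a k) (C k)) (h : ∀ k l, ∀ y ∈ C k, y ∈ C l → a k y = a l y) :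
    ∃ c : Y → Z, ContinuousOn c (⋃ k, C k) ∧ ∀ k, ∀ y ∈ C k, c y = a k y := by
  classical
  let c : Y → Z := fun y => if hy : ∃ k, y ∈ C k then a hy.choose y else Classical.arbitrary Z
  have hc : ∀ k, ∀ y ∈ C k, c y = a k y := fun k y hy => by
    have hy' : ∃ k, y ∈ C k := ⟨k, hy⟩
    simp only [c, dif_pos hy']
    exact h _ _ y hy'.choose_spec hy
  exact ⟨c, (locallyFinite_of_finite C).continuousOn_iUnion hC
    fun k => (ha k).congr (hc k), hc⟩

end Box

/-! ### Compression of cubes -/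

section Compression

variable {A B C : Type u} [TopologicalSpace A] [TopologicalSpace B] [TopologicalSpace C]

/-- The domain is nonempty if the codomain is, and every cube in `B` whose boundary lifts to `A` can
be deformed relative to its boundary to a cube that lifts to `A`. -/
structure IsCompressing (f : C(A, B)) : Prop where
  nonempty : Nonempty B → Nonempty A
  exists_compression : ∀ (N : Type) [Finite N] (b : C(N → I, B)) (a : (N → I) → A),
    ContinuousOn a (Cube.boundary N) → (∀ x ∈ Cube.boundary N, f (a x) = b x) →
      ∃ (a' : C(N → I, A)) (h : C((N → I) × I, B)), (∀ x ∈ Cube.boundary N, a' x = a x) ∧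
        (∀ x, h (x, 0) = b x) ∧ (∀ x, h (x, 1) = f (a' x)) ∧
          ∀ x ∈ Cube.boundary N, ∀ t, h (x, t) = b x

theorem IsCompressing.exists_of_homeomorph {f : C(A, B)} (hf : IsCompressing f) {N K : Type}
    [Finite N] [TopologicalSpace K] (e : K ≃ₜ (N → I)) (b : C(K, B)) (a : K → A)
    (ha : ContinuousOn a (e ⁻¹' Cube.boundary N)) (hab : ∀ x, e x ∈ Cube.boundary N → f (a x) = b x) :
    ∃ (a' : C(K, A)) (h : C(K × I, B)), (∀ x, e x ∈ Cube.boundary N → a' x = a x) ∧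
      (∀ x, h (x, 0) = b x) ∧ (∀ x, h (x, 1) = f (a' x)) ∧
        ∀ x, e x ∈ Cube.boundary N → ∀ t, h (x, t) = b x := by
  obtain ⟨a', h, h1, h2, h3, h4⟩ := hf.exists_compression N (b.comp ⟨e.symm, e.symm.continuous⟩) (a ∘ e.symm)
    (ha.comp e.symm.continuous.continuousOn fun x hx => by simpa using hx)
    (fun x hx => hab _ (by simpa using hx))
  refine ⟨a'.comp ⟨e, e.continuous⟩, h.comp ⟨fun z => (e z.1, z.2), by fun_prop⟩,
    fun x hx => ?_, fun x => ?_, fun x => ?_, fun x hx t => ?_⟩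
  · simpa using h1 (e x) hx
  · simpa using h2 (e x)
  · simpa using h3 (e x)
  · simpa using h4 (e x) hx t

/-- If the lifting problems for cubes relative to their boundary can be solved strictly, the map
is compressing. -/
theorem IsCompressing.of_lift {f : C(A, B)} (hne : Nonempty B → Nonempty A)
    (hf : ∀ (N : Type) [Finite N] (b : C(N → I, B)) (a : (N → I) → A),
      ContinuousOn a (Cube.boundary N) → (∀ x ∈ Cube.boundary N, f (a x) = b x) →
        ∃ a' : C(N → I, A), (∀ x ∈ Cube.boundary N, a' x = a x) ∧ ∀ x, f (a' x) = b x) :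
    IsCompressing f := by
  refine ⟨hne, fun N _ b a ha hab => ?_⟩
  obtain ⟨a', h1, h2⟩ := hf N b a ha hab
  exact ⟨a', b.comp ContinuousMap.fst, h1, fun _ => rfl, fun x => (h2 x).symm, fun _ _ _ => rfl⟩

theorem IsCompressing.of_inverse {f : C(A, B)} (g : C(B, A)) (hfg : ∀ x, f (g x) = x)
    (hgf : ∀ x, g (f x) = x) : IsCompressing f :=
  .of_lift (fun ⟨b⟩ => ⟨g b⟩) fun _ _ b a _ hab => ⟨g.comp b, fun x hx => by
    change g (b x) = a x
    rw [← hab x hx, hgf], fun x => hfg _⟩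

theorem Cube.isClosed_face {N : Type} (i : N) (t : I) : IsClosed {x : N → I | x i = t} :=
  isClosed_eq (continuous_apply i) continuous_const

theorem Cube.isClosed_boundary {N : Type} [Finite N] : IsClosed (Cube.boundary N) := by
  have : Cube.boundary N = ⋃ i, ({x : N → I | x i = 0} ∪ {x | x i = 1}) := by
    ext; simp [Cube.boundary]
  rw [this]
  exact isClosed_iUnion_of_finite fun i => (isClosed_face i 0).union (isClosed_face i 1)

theorem IsCompressing.surjective_pi0Map {f : C(A, B)} (hf : IsCompressing f) :
    Function.Surjective (pi0Map f) := by
  rintro ⟨b⟩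
  -- A 0-cube has empty boundary, yet the compression property expects a total function a; the
  -- default value comes from the nonemptiness clause.
  obtain ⟨a₀⟩ := hf.nonempty ⟨b⟩
  have hE : ∀ x : Empty → I, x ∉ Cube.boundary Empty := fun _ ⟨i, _⟩ => i.elim
  obtain ⟨a', h, -, h0, h1, -⟩ := hf.exists_compression Empty (.const _ b) (fun _ => a₀)
    continuousOn_const fun x hx => (hE x hx).elim
  let e : Empty → I := Empty.elim
  exact ⟨.mk (a' e), Quotient.sound ⟨Path.symm ⟨⟨fun t => h (e, t), by fun_prop⟩, h0 _, h1 _⟩⟩⟩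

/-- A path between the images is a 1-cube whose endpoints lift; its compression lifts to a path with
the given endpoints. -/
theorem IsCompressing.injective_pi0Map {f : C(A, B)} (hf : IsCompressing f) :
    Function.Injective (pi0Map f) := by
  rintro ⟨a₀⟩ ⟨a₁⟩ h
  obtain ⟨γ⟩ : Joined (f a₀) (f a₁) := Quotient.exact h
  have : Nonempty A := ⟨a₀⟩
  obtain ⟨c, hc, hc'⟩ := exists_continuousOn_glue (Y := Unit → I) (Z := A) (T := Bool)
    (fun k => {x | x () = if k then 1 else 0}) (fun k _ => if k then a₁ else a₀)
    (fun k => Cube.isClosed_face _ _) (fun k => continuousOn_const) (by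
      intro k l y hk hl
      have : k = l := by
        cases k <;> cases l <;> simp_all
      rw [this])
  have hc0 := hc' false
  have hc1 := hc' true
  simp only [Bool.false_eq_true, if_false, if_true, Set.mem_ofPred_eq] at hc0 hc1
  have hU : Cube.boundary Unit = ⋃ k : Bool, {x : Unit → I | x () = if k then 1 else 0} := by
    ext x; simp [Cube.boundary, Unique.exists_iff]
  obtain ⟨a', -, h1, -⟩ := hf.exists_compression Unit (γ.toContinuousMap.comp ⟨fun x => x (), by fun_prop⟩) c
    (hU ▸ hc) (by
      rintro x ⟨⟨⟩, hx | hx⟩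
      · simp [hc0 x hx, hx]
      · simp [hc1 x hx, hx])
  refine Quotient.sound ⟨⟨⟨fun t => a' fun _ => t, by fun_prop⟩, ?_, ?_⟩⟩
  · exact (h1 _ ⟨(), Or.inl rfl⟩).trans (hc0 _ rfl)
  · exact (h1 _ ⟨(), Or.inr rfl⟩).trans (hc1 _ rfl)

theorem IsCompressing.surjective_piMap {f : C(A, B)} (hf : IsCompressing f) (n : ℕ) (a : A) :
    Function.Surjective (piMap f n a) := by
  rintro ⟨q⟩
  obtain ⟨a', h, h1, h2, h3, h4⟩ := hf.exists_compression (Fin n) q.1 (fun _ => a) continuousOn_const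
    (fun x hx => (q.2 x hx).symm)
  refine ⟨Quotient.mk _ ⟨a', h1⟩, Quotient.sound (GenLoop.Homotopic.symm ?_)⟩
  exact ⟨⟨⟨h.comp ContinuousMap.prodSwap, h2, h3⟩, fun t x hx => h4 x hx t⟩⟩

/-- The cube as a product of a cube with an interval. -/
def cubeProdI (N : Type) : (N → I) × I ≃ₜ (N ⊕ Unit → I) where
  toFun z := Sum.elim z.1 fun _ => z.2
  invFun x := (fun i => x (.inl i), x (.inr ()))
  left_inv _ := rfl
  right_inv x := by ext (_ | _) <;> rfl
  continuous_toFun := continuous_pi <| by rintro (_ | _) <;> dsimp <;> fun_prop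
  continuous_invFun := by fun_prop

theorem cubeProdI_mem_boundary {N : Type} {z : (N → I) × I} :
    cubeProdI N z ∈ Cube.boundary (N ⊕ Unit) ↔
      z.1 ∈ Cube.boundary N ∨ z.2 = 0 ∨ z.2 = 1 := by
  rw [Cube.boundary, Set.mem_ofPred_eq, Sum.exists]
  exact or_congr Iff.rfl ⟨fun ⟨_, h⟩ => h, fun h => ⟨(), h⟩⟩

/-- A homotopy between the images of p and q is an (n+1)-cube whose boundary lifts: by p and q at
the two ends, by the constant a on the sides. Its compression lifts to a homotopy from p to q. -/
theorem IsCompressing.injective_piMap {f : C(A, B)} (hf : IsCompressing f) (n : ℕ) (a : A) :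
    Function.Injective (piMap f n a) := by
  rintro ⟨p⟩ ⟨q⟩ h
  obtain ⟨γ⟩ : GenLoop.Homotopic (genLoopMap f n a p) (genLoopMap f n a q) := Quotient.exact h
  have : Nonempty A := ⟨a⟩
  obtain ⟨c, hc, hc'⟩ := exists_continuousOn_glue (Y := (Fin n → I) × I) (Z := A) (T := Fin 3)
    ![{z | z.2 = 0}, {z | z.2 = 1}, {z | z.1 ∈ Cube.boundary (Fin n)}]
    ![fun z => p z.1, fun z => q z.1, fun _ => a]
    (by
      intro k
      fin_cases k
      · exact isClosed_eq continuous_snd continuous_const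
      · exact isClosed_eq continuous_snd continuous_const
      · exact Cube.isClosed_boundary.preimage continuous_fst)
    (by
      intro k
      fin_cases k
      · exact (p.1.continuous.comp continuous_fst).continuousOn
      · exact (q.1.continuous.comp continuous_fst).continuousOn
      · exact continuousOn_const)
    (by
      have hp : ∀ z ∈ Cube.boundary (Fin n), p z = a := p.2
      have hq : ∀ z ∈ Cube.boundary (Fin n), q z = a := q.2
      intro k l y hk hl
      fin_cases k <;> fin_cases l <;> simp_all)
  have hc0 := hc' 0
  have hc1 := hc' 1
  have hc2 := hc' 2
  simp only [Matrix.cons_val, Set.mem_ofPred_eq] at hc0 hc1 hc2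
  obtain ⟨a', -, h1, -⟩ := hf.exists_of_homeomorph (cubeProdI (Fin n))
    (γ.1.1.comp ContinuousMap.prodSwap) c (hc.mono fun z hz => by
      rcases cubeProdI_mem_boundary.1 hz with hz | hz | hz
      · exact Set.mem_iUnion.2 ⟨2, hz⟩
      · exact Set.mem_iUnion.2 ⟨0, hz⟩
      · exact Set.mem_iUnion.2 ⟨1, hz⟩) (by
      rintro ⟨x, t⟩ hz
      rcases cubeProdI_mem_boundary.1 hz with hz | hz | hz
      · rw [hc2 _ hz]
        exact ((γ.2 t x hz).trans (congrArg f (p.2 x hz))).symm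
      · obtain rfl : t = 0 := hz
        rw [hc0 _ rfl]
        exact (γ.1.apply_zero x).symm
      · obtain rfl : t = 1 := hz
        rw [hc1 _ rfl]
        exact (γ.1.apply_one x).symm)
  refine Quotient.sound ⟨⟨⟨a'.comp ContinuousMap.prodSwap, fun x => ?_, fun x => ?_⟩,
    fun t x hx => ?_⟩⟩
  · exact (h1 (x, 0) (cubeProdI_mem_boundary.2 (.inr (.inl rfl)))).trans (hc0 _ rfl)
  · exact (h1 (x, 1) (cubeProdI_mem_boundary.2 (.inr (.inr rfl)))).trans (hc1 _ rfl)
  · exact (h1 (x, t) (cubeProdI_mem_boundary.2 (.inl hx))).trans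
      ((hc2 _ hx).trans (p.2 x hx).symm)

theorem IsCompressing.isWeakHomotopyEquiv {f : C(A, B)} (hf : IsCompressing f) :
    IsWeakHomotopyEquiv f :=
  ⟨⟨hf.injective_pi0Map, hf.surjective_pi0Map⟩,
    fun n _ a => ⟨hf.injective_piMap n a, hf.surjective_piMap n a⟩⟩

theorem IsCompressing.weaklyEquivalent {f : C(A, B)} (hf : IsCompressing f) :
    WeaklyEquivalent A B :=
  .rel _ _ ⟨f, hf.isWeakHomotopyEquiv⟩

/-- The map of `n`-fold loop spaces induced by a map. -/
def loopMap (f : C(A, B)) (n : ℕ) (a : A) : C(GenLoop (Fin n) A a, GenLoop (Fin n) B (f a)) where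
  toFun := genLoopMap f n a
  continuous_toFun := Continuous.subtype_mk
    ((ContinuousMap.continuous_postcomp f).comp continuous_subtype_val) _

/-- The product of two cubes. -/
def cubeProd (N M : Type) : (N → I) × (M → I) ≃ₜ (N ⊕ M → I) :=
  Homeomorph.sumArrowHomeomorphProdArrow.symm

theorem cubeProd_mem_boundary {N M : Type} {z : (N → I) × (M → I)} :
    cubeProd N M z ∈ Cube.boundary (N ⊕ M) ↔ z.1 ∈ Cube.boundary N ∨ z.2 ∈ Cube.boundary M := by
  rw [Cube.boundary, Set.mem_ofPred_eq, Sum.exists]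
  rfl

/-- By adjunction, a cube of n-fold loops is a cube with n more coordinates. Its boundary lifts by a
in the old directions and by a₀ in the new ones, and a compression of the larger cube relative to
its boundary curries back to one through loops. -/
theorem IsCompressing.loopMap {f : C(A, B)} (hf : IsCompressing f) (n : ℕ) (a₀ : A) :
    IsCompressing (loopMap f n a₀) := by
  refine ⟨fun _ => ⟨GenLoop.const⟩, fun N _ b a ha hab => ?_⟩
  have : Nonempty A := ⟨a₀⟩
  obtain ⟨c, hc, hc'⟩ := exists_continuousOn_glue (Y := (N → I) × (Fin n → I)) (Z := A) (T := Fin 2)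
    ![{z | z.1 ∈ Cube.boundary N}, {z | z.2 ∈ Cube.boundary (Fin n)}]
    ![fun z => a z.1 z.2, fun _ => a₀]
    (by
      intro k
      fin_cases k
      · exact Cube.isClosed_boundary.preimage continuous_fst
      · exact Cube.isClosed_boundary.preimage continuous_snd)
    (by
      intro k
      fin_cases k
      · exact ContinuousOn.eval (F := GenLoop (Fin n) A a₀)
          (ha.comp continuousOn_fst fun z hz => hz) continuousOn_snd
      · exact continuousOn_const)
    (by
      have hp : ∀ x, ∀ y ∈ Cube.boundary (Fin n), a x y = a₀ := fun x => (a x).2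
      intro k l y hk hl
      fin_cases k <;> fin_cases l <;> simp_all)
  have hc0 := hc' 0
  have hc1 := hc' 1
  simp only [Matrix.cons_val, Set.mem_ofPred_eq] at hc0 hc1
  obtain ⟨a', h, h1, h2, h3, h4⟩ := hf.exists_of_homeomorph (cubeProd N (Fin n))
    ⟨fun z => b z.1 z.2, by fun_prop⟩ c (hc.mono fun z hz => by
      rcases cubeProd_mem_boundary.1 hz with hz | hz
      · exact Set.mem_iUnion.2 ⟨0, hz⟩
      · exact Set.mem_iUnion.2 ⟨1, hz⟩) (by
      rintro ⟨x, y⟩ hz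
      rcases cubeProd_mem_boundary.1 hz with hz | hz
      · rw [hc0 _ hz]
        exact congrArg (fun q : GenLoop (Fin n) B (f a₀) => q y) (hab x hz)
      · rw [hc1 _ hz]
        exact ((b x).2 y hz).symm)
  refine ⟨⟨fun x => ⟨a'.curry x, fun y hy => ?_⟩, a'.curry.continuous.subtype_mk _⟩,
    ⟨fun z => ⟨⟨fun y => h ((z.1, y), z.2), by fun_prop⟩, fun y hy => ?_⟩, ?_⟩,
    fun x hx => ?_, fun x => ?_, fun x => ?_, fun x hx t => ?_⟩
  · exact (h1 (x, y) (cubeProd_mem_boundary.2 (.inr hy))).trans (hc1 _ hy)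
  · exact (h4 (z.1, y) (cubeProd_mem_boundary.2 (.inr hy)) z.2).trans ((b z.1).2 y hy)
  · refine Continuous.subtype_mk (ContinuousMap.continuous_of_continuous_uncurry _ ?_) _
    change Continuous fun w : ((N → I) × I) × (Fin n → I) => h ((w.1.1, w.2), w.1.2)
    fun_prop
  · refine GenLoop.ext _ _ fun y => ?_
    exact (h1 (x, y) (cubeProd_mem_boundary.2 (.inl hx))).trans (hc0 _ hx)
  · exact GenLoop.ext _ _ fun y => h2 (x, y)
  · exact GenLoop.ext _ _ fun y => h3 (x, y)
  · exact GenLoop.ext _ _ fun y => h4 (x, y) (cubeProd_mem_boundary.2 (.inl hx)) t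

/-- The strict fiber of a map. -/
abbrev Fiber (g : C(A, B)) (b : B) : Type u := {a : A // g a = b}

/-- The inclusion of the strict fiber into the homotopy fiber. -/
def fiberInclusion (g : C(A, B)) (b : B) : C(Fiber g b, Hofiber g b) where
  toFun a := ⟨(a.1, ContinuousMap.const I b), a.2.symm, rfl⟩
  continuous_toFun := by fun_prop

/-- Lifting the path of a point of the homotopy fiber moves the point into the strict fiber. Over
the boundary of the cube the paths are constant, so a box lift can be kept constant there. -/
theorem IsSerreFibration.isCompressing_fiberInclusion {g : C(A, B)} (hg : IsSerreFibration g)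
    (b₀ : B) : IsCompressing (fiberInclusion g b₀) := by
  refine ⟨fun ⟨b⟩ => ?_, fun N _ b a ha hab => ?_⟩
  · obtain ⟨G, -, hG⟩ := hg 0 (b.1.2.comp ContinuousMap.snd) (.const _ b.1.1) fun _ => b.2.1.symm
    exact ⟨⟨G (0, 1), (hG _).trans b.2.2⟩⟩
  have hpath : ∀ x ∈ Cube.boundary N, ∀ t, (b x).1.2 t = b₀ := fun x hx t => by
    rw [← hab x hx]; rfl
  have hpt : ∀ x ∈ Cube.boundary N, (b x).1.1 = (a x).1 := fun x hx => by
    rw [← hab x hx]; rfl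
  obtain ⟨l, hl, hgl⟩ := hg.exists_box_lift (cubeProdI N) (D := Set.range .inl)
    (E := Set.range .inr) (by simp [Set.disjoint_left]) (Set.range_nonempty _)
    (fun z => (b z.1).1.1) (by fun_prop) ⟨fun z => (b z.1).1.2 z.2, by fun_prop⟩ (by
      rintro ⟨x, t⟩ (⟨_, ⟨i, rfl⟩, hz⟩ | ⟨_, ⟨_, rfl⟩, hz⟩)
      · have hx : x ∈ Cube.boundary N := ⟨i, hz⟩
        refine ((b x).2.1.symm.trans (hpath x hx 0)).trans (hpath x hx t).symm
      · obtain rfl : t = 0 := hz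
        exact (b x).2.1.symm)
  have hl0 : ∀ x, l (x, 0) = (b x).1.1 := fun x => hl (x, 0) (.inr ⟨_, ⟨(), rfl⟩, rfl⟩)
  have hlb : ∀ x ∈ Cube.boundary N, ∀ t, l (x, t) = (a x).1 := by
    rintro x ⟨i, hi⟩ t
    exact (hl (x, t) (.inl ⟨_, ⟨i, rfl⟩, hi⟩)).trans (hpt x ⟨i, hi⟩)
  -- At time t the point has moved to l(x, t), and the path still to be travelled is s ↦ γ(max t s).
  refine ⟨⟨fun x => ⟨l (x, 1), (hgl _).trans (b x).2.2⟩, by fun_prop⟩,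
    ⟨fun z => ⟨(l (z.1, z.2), ⟨fun s => (b z.1).1.2 (max z.2 s), by fun_prop⟩), ?_, ?_⟩, ?_⟩,
    fun x hx => Subtype.ext (hlb x hx 1), fun x => ?_, fun x => ?_, fun x hx t => ?_⟩
  · exact (congrArg (b z.1).1.2 (max_eq_left bot_le)).trans (hgl z).symm
  · exact (congrArg (b z.1).1.2 (max_eq_right le_top)).trans (b z.1).2.2
  · refine Continuous.subtype_mk (Continuous.prodMk (by fun_prop)
      (ContinuousMap.continuous_of_continuous_uncurry _ ?_)) _
    change Continuous fun w : ((N → I) × I) × I => (b w.1.1).1.2 (max w.1.2 w.2)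
    fun_prop
  · refine Subtype.ext (Prod.ext (hl0 x) (ContinuousMap.ext fun s => ?_))
    exact congrArg (b x).1.2 (max_eq_right bot_le)
  · refine Subtype.ext (Prod.ext rfl (ContinuousMap.ext fun s => ?_))
    exact (congrArg (b x).1.2 (max_eq_left le_top)).trans (b x).2.2
  · refine Subtype.ext (Prod.ext ((hlb x hx t).trans (hpt x hx).symm)
      (ContinuousMap.ext fun s => ?_))
    exact (hpath x hx _).trans (hpath x hx _).symm

end Compression

/-! ### The simplex as a cube -/

section Simplex

/-- The corner simplex `{x ≥ 0, ∑ x ≤ 1}`. -/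
def cornerSimplex (n : ℕ) : Set (Fin n → ℝ) := {x | (∀ i, 0 ≤ x i) ∧ ∑ i, x i ≤ 1}

theorem convex_cornerSimplex (n : ℕ) : Convex ℝ (cornerSimplex n) := by
  rintro x ⟨hx0, hx⟩ y ⟨hy0, hy⟩ a b ha hb hab
  refine ⟨fun i => add_nonneg (mul_nonneg ha (hx0 i)) (mul_nonneg hb (hy0 i)), ?_⟩
  simp only [Pi.add_apply, Pi.smul_apply, smul_eq_mul, Finset.sum_add_distrib, ← Finset.mul_sum]
  nlinarith

theorem isClosed_cornerSimplex (n : ℕ) : IsClosed (cornerSimplex n) := by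
  refine IsClosed.inter (s₁ := {x : Fin n → ℝ | ∀ i, 0 ≤ x i}) (s₂ := {x | ∑ i, x i ≤ 1}) ?_ ?_
  · simp only [Set.ofPred_forall]
    exact isClosed_iInter fun i => isClosed_le continuous_const (continuous_apply i)
  · exact isClosed_le (by fun_prop) continuous_const

theorem isBounded_cornerSimplex (n : ℕ) : Bornology.IsBounded (cornerSimplex n) := by
  refine (Metric.isBounded_iff_subset_closedBall 0).2 ⟨1, fun x hx => ?_⟩
  rw [mem_closedBall_zero_iff, pi_norm_le_iff_of_nonneg zero_le_one]
  intro i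
  rw [Real.norm_of_nonneg (hx.1 i)]
  exact (Finset.single_le_sum (fun k _ => hx.1 k) (Finset.mem_univ i)).trans hx.2

theorem interior_cornerSimplex (n : ℕ) :
    interior (cornerSimplex (n + 1)) = {x | (∀ i, 0 < x i) ∧ ∑ i, x i < 1} := by
  apply subset_antisymm
  · intro x hx
    -- An interior point can be moved slightly in any direction. Moving along (-1, …, -1) forces
    -- positive coordinates, moving along the first basis vector forces a sum below 1.
    have hline : ∀ v : Fin (n + 1) → ℝ, ∃ ε > (0 : ℝ), x + ε • v ∈ cornerSimplex (n + 1) := fun v => by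
      have hc : Continuous fun t : ℝ => x + t • v := by fun_prop
      have h0 : ∀ᶠ t in nhds (0 : ℝ), x + t • v ∈ cornerSimplex (n + 1) :=
        hc.continuousAt.eventually_mem (by simpa using mem_interior_iff_mem_nhds.1 hx)
      obtain ⟨ε, hε, h⟩ := Metric.eventually_nhds_iff.1 h0
      exact ⟨ε / 2, half_pos hε, h (by
        rw [Real.dist_0_eq_abs, abs_of_pos (half_pos hε)]; exact half_lt_self hε)⟩
    refine ⟨fun i => ?_, ?_⟩
    · obtain ⟨ε, hε, h⟩ := hline (fun _ => -1)
      have := h.1 i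
      simp only [Pi.add_apply, Pi.smul_apply, smul_eq_mul] at this
      linarith
    · obtain ⟨ε, hε, h⟩ := hline (Pi.single 0 1)
      have := h.2
      simp only [Pi.add_apply, Pi.smul_apply, smul_eq_mul, Finset.sum_add_distrib,
        ← Finset.mul_sum, Fintype.sum_pi_single'] at this
      linarith
  · refine interior_maximal (fun x hx => ⟨fun i => (hx.1 i).le, hx.2.le⟩) ?_
    refine IsOpen.inter (s := {x : Fin (n + 1) → ℝ | ∀ i, 0 < x i}) (t := {x | ∑ i, x i < 1}) ?_ ?_
    · simp only [Set.ofPred_forall]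
      exact isOpen_iInter_of_finite fun i => isOpen_lt continuous_const (continuous_apply i)
    · exact isOpen_lt (by fun_prop) continuous_const

/-- The corner simplex is the standard simplex. -/
def cornerSimplexHomeo (n : ℕ) : cornerSimplex n ≃ₜ stdSimplex ℝ (Fin (n + 1)) where
  toFun x := ⟨Fin.cons (1 - ∑ i, x.1 i) x.1, fun i => by
    refine Fin.cases ?_ (fun i => ?_) i
    · simpa using x.2.2
    · simpa using x.2.1 i, by simp [Fin.sum_univ_succ]⟩
  invFun t := ⟨fun i => t.1 i.succ, fun i => t.2.1 _, by
    have := t.2.2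
    rw [Fin.sum_univ_succ] at this
    linarith [t.2.1 0]⟩
  left_inv x := rfl
  right_inv t := Subtype.ext <| funext fun i => by
    refine Fin.cases ?_ (fun i => rfl) i
    have := t.2.2
    rw [Fin.sum_univ_succ] at this
    simp only [Fin.cons_zero]
    linarith
  continuous_toFun := by
    refine Continuous.subtype_mk (continuous_pi fun i => ?_) _
    refine Fin.cases ?_ (fun i => ?_) i <;> simp only [Fin.cons_zero, Fin.cons_succ]
    · exact continuous_const.sub (continuous_finsetSum _ fun i _ =>
        (continuous_apply i).comp continuous_subtype_val)
    · exact (continuous_apply i).comp continuous_subtype_val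
  continuous_invFun := Continuous.subtype_mk (continuous_pi fun i =>
    (continuous_apply i.succ).comp continuous_subtype_val) _

/-- The cube as the unit ball of the supremum norm. -/
def cubeHomeoClosedBall (n : ℕ) : (Fin n → I) ≃ₜ Metric.closedBall (0 : Fin n → ℝ) 1 where
  toFun y := ⟨fun i => 2 * y i - 1, by
    rw [mem_closedBall_zero_iff, pi_norm_le_iff_of_nonneg zero_le_one]
    intro i
    have h0 := (y i).2.1
    have h1 := (y i).2.2
    rw [Real.norm_eq_abs, abs_le]
    constructor <;> linarith⟩
  invFun x := fun i => ⟨(x.1 i + 1) / 2, by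
    have h := (norm_le_pi_norm x.1 i).trans (mem_closedBall_zero_iff.1 x.2)
    rw [Real.norm_eq_abs, abs_le] at h
    constructor <;> linarith⟩
  left_inv y := funext fun i => Subtype.ext (by simp)
  right_inv x := Subtype.ext (funext fun i => by simp; ring)
  continuous_toFun := by fun_prop
  continuous_invFun := continuous_pi fun i => Continuous.subtype_mk
    ((((continuous_apply i).comp continuous_subtype_val).add continuous_const).div_const 2) _

theorem cubeHomeoClosedBall_mem_sphere {n : ℕ} (y : Fin (n + 1) → I) :
    (cubeHomeoClosedBall (n + 1) y).1 ∈ Metric.sphere (0 : Fin (n + 1) → ℝ) 1 ↔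
      y ∈ Cube.boundary (Fin (n + 1)) := by
  have hc : ∀ i, (cubeHomeoClosedBall (n + 1) y).1 i = 2 * y i - 1 := fun _ => rfl
  rw [mem_sphere_zero_iff_norm]
  constructor
  · intro h
    by_contra hy
    have hlt : ‖(cubeHomeoClosedBall (n + 1) y).1‖ < 1 := by
      rw [pi_norm_lt_iff zero_lt_one]
      intro i
      have h0 : y i ≠ 0 := fun h => hy ⟨i, .inl h⟩
      have h1 : y i ≠ 1 := fun h => hy ⟨i, .inr h⟩
      have h0' := unitInterval.pos_iff_ne_zero.2 h0
      have h1' := unitInterval.lt_one_iff_ne_one.2 h1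
      rw [← Subtype.coe_lt_coe] at h0' h1'
      rw [hc, Real.norm_eq_abs, abs_lt]
      simp only [Set.Icc.coe_zero, Set.Icc.coe_one] at h0' h1'
      constructor <;> linarith
    exact hlt.ne h
  · rintro ⟨i, hi⟩
    refine le_antisymm (mem_closedBall_zero_iff.1 (cubeHomeoClosedBall (n + 1) y).2) ?_
    refine le_trans ?_ (norm_le_pi_norm _ i)
    rw [hc]
    rcases hi with hi | hi <;> norm_num [hi]

/-- The simplex is homeomorphic to the cube, with boundaries corresponding to each other. -/
theorem exists_cube_homeo_simplex (n : ℕ) :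
    ∃ e : (Fin (n + 1) → I) ≃ₜ stdSimplex ℝ (Fin (n + 2)),
      ∀ y, y ∈ Cube.boundary (Fin (n + 1)) ↔ ∃ i, e y i = 0 := by
  have hne : (interior (cornerSimplex (n + 1))).Nonempty := by
    rw [interior_cornerSimplex]
    refine ⟨fun _ => 1 / (n + 2), fun i => by positivity, ?_⟩
    simp only [Finset.sum_const, Finset.card_univ, Fintype.card_fin, nsmul_eq_mul]
    push_cast
    rw [mul_one_div, div_lt_one (by positivity)]
    linarith
  -- A bounded convex set with nonempty interior is carried to the unit ball by an ambient
  -- homeomorphism that matches the frontiers. In the supremum norm the ball is a cube.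
  obtain ⟨h, -, h1, h2⟩ := exists_homeomorph_image_interior_closure_frontier_eq_unitBall
    (convex_cornerSimplex (n + 1)) hne (isBounded_cornerSimplex (n + 1))
  rw [(isClosed_cornerSimplex _).closure_eq] at h1
  let e₁ : cornerSimplex (n + 1) ≃ₜ Metric.closedBall (0 : Fin (n + 1) → ℝ) 1 :=
    (h.image _).trans (Homeomorph.setCongr h1)
  have he₁ : ∀ x, (e₁ x).1 = h x.1 := fun _ => rfl
  refine ⟨(cubeHomeoClosedBall (n + 1)).trans (e₁.symm.trans (cornerSimplexHomeo (n + 1))),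
    fun y => ?_⟩
  obtain ⟨x, hx⟩ := e₁.surjective (cubeHomeoClosedBall (n + 1) y)
  simp only [Homeomorph.trans_apply, ← cubeHomeoClosedBall_mem_sphere, ← hx,
    Homeomorph.symm_apply_apply]
  rw [he₁, ← h2, h.injective.mem_set_image, (isClosed_cornerSimplex _).frontier_eq,
    interior_cornerSimplex]
  have h0 : (cornerSimplexHomeo (n + 1) x) 0 = 1 - ∑ i, x.1 i := rfl
  have hs : ∀ i : Fin (n + 1), (cornerSimplexHomeo (n + 1) x) i.succ = x.1 i := fun _ => rfl
  rw [Fin.exists_fin_succ, h0]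
  simp only [hs, Set.mem_sdiff, Set.mem_ofPred_eq, not_and_or, not_forall, not_lt]
  constructor
  · rintro ⟨-, ⟨i, hi⟩ | h⟩
    · exact .inr ⟨i, le_antisymm hi (x.2.1 i)⟩
    · exact .inl (by linarith [x.2.2])
  · rintro (h | ⟨i, hi⟩)
    · exact ⟨x.2, .inr (by linarith)⟩
    · exact ⟨x.2, .inl ⟨i, hi.le⟩⟩

end Simplex

/-! ### Spaces of relative sections -/

section Sections

variable {A B : Type u} [TopologicalSpace A] [TopologicalSpace B] {M : Type}

/-- The space of maps from a cube that agree with `a` after composition with `p` and on the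
boundary. -/
abbrev RelSections (p : C(A, B)) (a : C(M → I, A)) : Type u :=
  {g : C(M → I, A) // (∀ y, p (g y) = p (a y)) ∧ ∀ y ∈ Cube.boundary M, g y = a y}

/-- The space of homotopies that agree with `a` after composition with `p` and on the boundary. -/
abbrev RelSectionHomotopies (p : C(A, B)) (a : C((M → I) × I, A)) : Type u :=
  {g : C((M → I) × I, A) //
    (∀ z, p (g z) = p (a z)) ∧ ∀ y ∈ Cube.boundary M, ∀ t, g (y, t) = a (y, t)}

/-- The map `f(-, t)`. -/
def slice (a : C((M → I) × I, A)) (t : I) : C(M → I, A) :=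
  a.comp (.prodMk (.id _) (.const _ t))

theorem continuous_slice (t : I) : Continuous fun a : C((M → I) × I, A) => slice a t :=
  ContinuousMap.continuous_precomp _

/-- Evaluation of homotopies of relative sections at time `t`. -/
def RelSectionHomotopies.eval (p : C(A, B)) (a : C((M → I) × I, A)) (t : I) :
    C(RelSectionHomotopies p a, RelSections p (slice a t)) where
  toFun g := ⟨slice g.1 t, fun _ => g.2.1 _, fun y hy => g.2.2 y hy t⟩
  continuous_toFun := ((continuous_slice t).comp continuous_subtype_val).subtype_mk _

/-- Evaluation of homotopies of relative sections of a Serre fibration at an endpoint is a trivial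
Serre fibration. -/
theorem RelSectionHomotopies.isCompressing_eval [Finite M] {p : C(A, B)} (hp : IsSerreFibration p)
    (a : C((M → I) × I, A)) {t₀ : I} (r : I ≃ₜ I) (hr : r t₀ = 0) :
    IsCompressing (RelSectionHomotopies.eval p a t₀) := by
  refine .of_lift (fun _ => ⟨⟨a, fun _ => rfl, fun _ _ _ => rfl⟩⟩) fun N _ b c hc hbc => ?_
  have : Nonempty A := ⟨a (0, 0)⟩
  let e : (N → I) × ((M → I) × I) ≃ₜ (N ⊕ (M ⊕ Unit) → I) :=
    ((Homeomorph.refl _).prodCongr (((Homeomorph.refl _).prodCongr r).trans (cubeProdI M))).trans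
      (cubeProd N (M ⊕ Unit))
  -- The lift is prescribed on all faces in the directions of N (by c) and of M (by a), but only on
  -- the face t = t₀ in the time direction (by b). The homeomorphism r turns that face into the
  -- initial one.
  let D : Set (N ⊕ (M ⊕ Unit)) := Set.range .inl ∪ Set.range (.inr ∘ .inl)
  let E : Set (N ⊕ (M ⊕ Unit)) := {.inr (.inr ())}
  have hDE : Disjoint D E := by
    rw [Set.disjoint_singleton_right]
    rintro (⟨i, hi⟩ | ⟨i, hi⟩)
    · exact Sum.inl_ne_inr hi
    · exact Sum.inl_ne_inr (Sum.inr_injective hi)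
  have hbox : ∀ z, e z ∈ box D E ↔
      z.1 ∈ Cube.boundary N ∨ z.2.1 ∈ Cube.boundary M ∨ z.2.2 = t₀ := by
    intro z
    have hz : r z.2.2 = 0 ↔ z.2.2 = t₀ := by rw [← hr, r.injective.eq_iff]
    rw [← hz]
    constructor
    · rintro (⟨_, ⟨i, rfl⟩ | ⟨i, rfl⟩, h⟩ | ⟨_, rfl, h⟩)
      · exact .inl ⟨i, h⟩
      · exact .inr (.inl ⟨i, h⟩)
      · exact .inr (.inr h)
    · rintro (⟨i, h⟩ | ⟨i, h⟩ | h)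
      · exact .inl ⟨_, .inl ⟨i, rfl⟩, h⟩
      · exact .inl ⟨_, .inr ⟨i, rfl⟩, h⟩
      · exact .inr ⟨_, rfl, h⟩
  have hslice : ∀ x ∈ Cube.boundary N, ∀ y, (c x).1 (y, t₀) = (b x).1 y := fun x hx y => by
    rw [← hbc x hx]; rfl
  obtain ⟨d, hd, hd'⟩ := exists_continuousOn_glue (Y := (N → I) × ((M → I) × I)) (Z := A)
    (T := Fin 3)
    ![{z | z.1 ∈ Cube.boundary N}, {z | z.2.1 ∈ Cube.boundary M}, {z | z.2.2 = t₀}]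
    ![fun z => (c z.1).1 z.2, fun z => a z.2, fun z => (b z.1).1 z.2.1]
    (by
      intro k
      fin_cases k
      · exact Cube.isClosed_boundary.preimage continuous_fst
      · exact Cube.isClosed_boundary.preimage (continuous_fst.comp continuous_snd)
      · exact isClosed_eq (continuous_snd.comp continuous_snd) continuous_const)
    (by
      intro k
      fin_cases k
      · exact ContinuousOn.eval (continuous_subtype_val.comp_continuousOn
          (hc.comp continuousOn_fst fun z hz => hz)) continuousOn_snd
      · exact (a.continuous.comp continuous_snd).continuousOn
      · exact Continuous.continuousOn (by dsimp; fun_prop))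
    (by
      have h01 : ∀ x, ∀ y ∈ Cube.boundary M, ∀ t, (c x).1 (y, t) = a (y, t) :=
        fun x => (c x).2.2
      have h12 : ∀ x, ∀ y ∈ Cube.boundary M, (b x).1 y = a (y, t₀) := fun x => (b x).2.2
      rintro k l ⟨x, y, t⟩ hk hl
      fin_cases k <;> fin_cases l
      · rfl
      · exact h01 x y hl t
      · obtain rfl : t = t₀ := hl
        exact hslice x hk y
      · exact (h01 x y hk t).symm
      · rfl
      · obtain rfl : t = t₀ := hl
        exact (h12 x y hk).symm
      · obtain rfl : t = t₀ := hk
        exact (hslice x hl y).symm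
      · obtain rfl : t = t₀ := hk
        exact h12 x y hl
      · rfl)
  have hd0 := hd' 0
  have hd1 := hd' 1
  have hd2 := hd' 2
  simp only [Matrix.cons_val, Set.mem_ofPred_eq] at hd0 hd1 hd2
  obtain ⟨l, hl, hpl⟩ := hp.exists_box_lift e hDE (Set.singleton_nonempty _) d
    (hd.mono fun z hz => by
      rcases (hbox z).1 hz with hz | hz | hz
      · exact Set.mem_iUnion.2 ⟨0, hz⟩
      · exact Set.mem_iUnion.2 ⟨1, hz⟩
      · exact Set.mem_iUnion.2 ⟨2, hz⟩) (p.comp (a.comp .snd)) (by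
      rintro ⟨x, y, t⟩ hz
      rcases (hbox _).1 hz with hz | hz | hz
      · rw [hd0 _ hz]
        exact (c x).2.1 _
      · rw [hd1 _ hz]
        rfl
      · rw [hd2 _ hz]
        obtain rfl : t = t₀ := hz
        exact (b x).2.1 y)
  refine ⟨⟨fun x => ⟨l.curry x, fun z => hpl (x, z), fun y hy t => ?_⟩,
    l.curry.continuous.subtype_mk _⟩, fun x hx => ?_, fun x => ?_⟩
  · exact (hl (x, y, t) ((hbox _).2 (.inr (.inl hy)))).trans (hd1 _ hy)
  · refine Subtype.ext (ContinuousMap.ext fun z => ?_)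
    exact (hl (x, z) ((hbox _).2 (.inl hx))).trans (hd0 _ hx)
  · refine Subtype.ext (ContinuousMap.ext fun y => ?_)
    exact (hl (x, y, t₀) ((hbox _).2 (.inr (.inr rfl)))).trans (hd2 _ rfl)

/-- The space of homotopies of relative sections maps to both sides by evaluation at its ends.
Reflecting the interval reduces the end 1 to the end 0. -/
theorem RelSections.weaklyEquivalent_slice [Finite M] {p : C(A, B)} (hp : IsSerreFibration p)
    (a : C((M → I) × I, A)) :
    WeaklyEquivalent (RelSections p (slice a 0)) (RelSections p (slice a 1)) := by
  refine .trans _ (TopCat.of (RelSectionHomotopies p a)) _ (.symm _ _ ?_) ?_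
  · exact (RelSectionHomotopies.isCompressing_eval hp a (.refl _) rfl).weaklyEquivalent
  · exact (RelSectionHomotopies.isCompressing_eval hp a unitInterval.symmHomeomorph
      (by simp)).weaklyEquivalent

/-- A contraction of the cube onto the point `y₀`. -/
def cubeContraction (y₀ : M → I) : C((M → I) × I, M → I) where
  toFun z i := ⟨(1 - z.2) * z.1 i + z.2 * y₀ i, convex_Icc (0 : ℝ) 1 (z.1 i).2 (y₀ i).2
    (sub_nonneg.2 z.2.2.2) z.2.2.1 (sub_add_cancel _ _)⟩
  continuous_toFun := by fun_prop

theorem cubeContraction_zero (y₀ y : M → I) : cubeContraction y₀ (y, 0) = y := by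
  ext i; simp [cubeContraction]

theorem cubeContraction_one (y₀ y : M → I) : cubeContraction y₀ (y, 1) = y₀ := by
  ext i; simp [cubeContraction]

/-- The relative sections with values in a single fiber form a loop space. -/
theorem RelSections.weaklyEquivalent_genLoop {n : ℕ} (p : C(A, B)) (a : C(Fin n → I, A)) {a₀ : A}
    (ha : ∀ y, a y = a₀) :
    WeaklyEquivalent (RelSections p a) (GenLoop (Fin n) (Fiber p (p a₀)) ⟨a₀, rfl⟩) := by
  let F : C(RelSections p a, GenLoop (Fin n) (Fiber p (p a₀)) ⟨a₀, rfl⟩) :=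
    ⟨fun g => ⟨⟨fun y => ⟨g.1 y, (g.2.1 y).trans (congrArg p (ha y))⟩, by fun_prop⟩,
      fun y hy => Subtype.ext ((g.2.2 y hy).trans (ha y))⟩, by
      refine Continuous.subtype_mk (ContinuousMap.continuous_of_continuous_uncurry _ ?_) _
      exact Continuous.subtype_mk (by fun_prop) _⟩
  let G : C(GenLoop (Fin n) (Fiber p (p a₀)) ⟨a₀, rfl⟩, RelSections p a) :=
    ⟨fun g => ⟨⟨fun y => (g y).1, by fun_prop⟩, fun y => (g y).2.trans (congrArg p (ha y).symm),
      fun y hy => (congrArg Subtype.val (g.2 y hy)).trans (ha y).symm⟩, by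
      refine Continuous.subtype_mk (ContinuousMap.continuous_of_continuous_uncurry _ ?_) _
      exact continuous_subtype_val.comp continuous_eval⟩
  exact (IsCompressing.of_inverse (f := F) G (fun _ => rfl) fun _ => rfl).weaklyEquivalent

/-- If `a` is any map from a cube to the total space of a Serre fibration, the space of sections
relative to `a` is an iterated loop space of the fiber. -/
theorem IsSerreFibration.weaklyEquivalent_relSections {n : ℕ} {p : C(A, B)}
    (hp : IsSerreFibration p) (a : C(Fin n → I, A)) (y₀ : Fin n → I) :
    WeaklyEquivalent (RelSections p a)
      (GenLoop (Fin n) (Fiber p (p (a y₀))) ⟨a y₀, rfl⟩) := by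
  have h0 : slice (a.comp (cubeContraction y₀)) 0 = a :=
    ContinuousMap.ext fun y => congrArg a (cubeContraction_zero y₀ y)
  have h := RelSections.weaklyEquivalent_slice hp (a.comp (cubeContraction y₀))
  rw [h0] at h
  exact h.trans _ _ _ (RelSections.weaklyEquivalent_genLoop p _
    fun y => congrArg a (cubeContraction_one y₀ y))

end Sections

/-! ### The tower of partial totalizations -/

section Tower

/-- The map of simplices induced by a map of the simplex category. -/
def simplexMap {p q : ℕ} (θ : SimplexCategory.mk p ⟶ SimplexCategory.mk q)
    (t : stdSimplex ℝ (Fin (p + 1))) : stdSimplex ℝ (Fin (q + 1)) :=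
  stdSimplex.map (fun k : Fin (p + 1) => θ.toOrderHom k) t

@[fun_prop]
theorem continuous_simplexMap {p q : ℕ} (θ : SimplexCategory.mk p ⟶ SimplexCategory.mk q) :
    Continuous (simplexMap θ) :=
  stdSimplex.continuous_map _

theorem simplexMap_comp {p q r : ℕ} (θ : SimplexCategory.mk p ⟶ SimplexCategory.mk q)
    (θ' : SimplexCategory.mk q ⟶ SimplexCategory.mk r) (t : stdSimplex ℝ (Fin (p + 1))) :
    simplexMap (θ ≫ θ') t = simplexMap θ' (simplexMap θ t) := by
  unfold simplexMap
  rw [stdSimplex.map_comp_apply]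
  rfl

theorem simplexMap_apply {p q : ℕ} (θ : SimplexCategory.mk p ⟶ SimplexCategory.mk q)
    (t : stdSimplex ℝ (Fin (p + 1))) (i : Fin (q + 1)) :
    simplexMap θ t i = ∑ k with θ.toOrderHom k = i, t k :=
  FunOnFinite.linearMap_apply_apply ..

theorem simplexMap_id {p : ℕ} (t : stdSimplex ℝ (Fin (p + 1))) :
    simplexMap (𝟙 (SimplexCategory.mk p)) t = t :=
  stdSimplex.map_id_apply t

theorem simplexMap_apply_eq_zero {p q : ℕ} {θ : SimplexCategory.mk p ⟶ SimplexCategory.mk q}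
    (t : stdSimplex ℝ (Fin (p + 1))) {i : Fin (q + 1)} (h : ∀ k, θ.toOrderHom k ≠ i) :
    simplexMap θ t i = 0 := by
  rw [simplexMap_apply, Finset.filter_false_of_mem fun k _ => h k, Finset.sum_empty]

/-- A retraction of the coface `δ i`. -/
def faceRetraction {n : ℕ} (i : Fin (n + 2)) :
    SimplexCategory.mk (n + 1) ⟶ SimplexCategory.mk n :=
  SimplexCategory.σ (Fin.predAbove (Fin.last n) i)

theorem δ_faceRetraction {n : ℕ} (i : Fin (n + 2)) :
    SimplexCategory.δ i ≫ faceRetraction i = 𝟙 _ := by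
  unfold faceRetraction
  by_cases h : i = Fin.last (n + 1)
  · subst h
    rw [Fin.predAbove_right_last]
    exact SimplexCategory.δ_comp_σ_succ' (by simp)
  · have : i = (Fin.predAbove (Fin.last n) i).castSucc := by
      rw [Fin.predAbove_last_of_ne_last h, Fin.castSucc_castPred]
    exact SimplexCategory.δ_comp_σ_self' this

/-- A boundary point is the image of a point of the simplex on its support, whose dimension is at
most n. This presentation does not depend on which vanishing coordinate is used, so prescriptions on
different faces can be compared through it. -/
theorem exists_support {n : ℕ} (t : stdSimplex ℝ (Fin (n + 2))) (h : ∃ i, t i = 0) :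
    ∃ (r : Fin (n + 1)) (φ : SimplexCategory.mk r.1 ⟶ SimplexCategory.mk (n + 1))
      (u : stdSimplex ℝ (Fin (r.1 + 1))),
      simplexMap φ u = t ∧ ∀ k, t (φ.toOrderHom k) ≠ 0 := by
  classical
  let S : Finset (Fin (n + 2)) := Finset.univ.filter fun i => t i ≠ 0
  have hS : S.Nonempty := by
    by_contra hS
    rw [Finset.not_nonempty_iff_eq_empty, Finset.filter_eq_empty_iff] at hS
    have := stdSimplex.sum_eq_one t
    simp only [Finset.mem_univ, ne_eq, not_not, true_imp_iff] at hS
    simp [hS] at this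
  have hcard : S.card < n + 2 := by
    obtain ⟨i, hi⟩ := h
    have : S ⊂ Finset.univ := (Finset.ssubset_univ_iff).2 fun hS => by
      have : i ∈ S := hS ▸ Finset.mem_univ i
      simp [S, hi] at this
    simpa using Finset.card_lt_card this
  obtain ⟨r, hr⟩ : ∃ r, S.card = r + 1 := ⟨S.card - 1, by have := hS.card_pos; omega⟩
  let ψ := S.orderEmbOfFin hr
  have hmem : ∀ k, t (ψ k) ≠ 0 := fun k => by
    exact (Finset.mem_filter.1 (S.orderEmbOfFin_mem hr k)).2
  have hsurj : ∀ i, t i ≠ 0 → ∃ k, ψ k = i := fun i hi => by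
    have : i ∈ Set.range ψ := by
      rw [Finset.range_orderEmbOfFin]
      simpa [S] using hi
    exact this
  have hsum : ∀ (P : Fin (n + 2) → Prop) [DecidablePred P], ∑ k with P (ψ k), t (ψ k) = ∑ i with P i, t i := fun P _ => by
    refine Finset.sum_of_injOn ψ ψ.injective.injOn (fun k hk => by simpa using hk) ?_
      (fun _ _ => rfl)
    intro i hi hi'
    by_contra hne
    obtain ⟨k, rfl⟩ := hsurj i hne
    exact hi' ⟨k, by simpa using hi, rfl⟩
  let φ : SimplexCategory.mk r ⟶ SimplexCategory.mk (n + 1) :=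
    SimplexCategory.mkHom ψ.toOrderHom
  let u : stdSimplex ℝ (Fin (r + 1)) := ⟨fun k => t (ψ k), fun k => stdSimplex.zero_le _ _, by
    simpa using hsum fun _ => True⟩
  refine ⟨⟨r, by omega⟩, φ, u, stdSimplex.ext (funext fun i => ?_), hmem⟩
  rw [simplexMap_apply]
  have h := hsum fun k => k = i
  rw [Finset.sum_filter (fun k => k = i), Finset.sum_ite_eq' Finset.univ i,
    if_pos (Finset.mem_univ i)] at h
  convert! h

/-- The support of t misses i, so t comes from the i-th face, on which the retraction inverts the
coface. -/
theorem simplexMap_faceRetraction {n : ℕ} {t : stdSimplex ℝ (Fin (n + 2))} {i : Fin (n + 2)}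
    (h : t i = 0) : simplexMap (SimplexCategory.δ i) (simplexMap (faceRetraction i) t) = t := by
  obtain ⟨r, φ, u, rfl, hφ⟩ := exists_support t ⟨i, h⟩
  obtain ⟨ψ, rfl⟩ := SimplexCategory.eq_comp_δ_of_not_surjective' φ i fun k hk => hφ k (hk ▸ h)
  rw [← simplexMap_comp, ← simplexMap_comp]
  rw [Category.assoc, ← Category.assoc (SimplexCategory.δ i), δ_faceRetraction, Category.id_comp]

variable {X : CosimplicialObject TopCat.{u}} {n : ℕ}

namespace Tot

/-- The component of highest degree. -/
def top (f : Tot X n) : C(stdSimplex ℝ (Fin (n + 1)), X.obj (SimplexCategory.mk n)) :=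
  f.1 (Fin.last n)

theorem continuous_top : Continuous (top : Tot X n → _) :=
  (continuous_apply (Fin.last n)).comp continuous_subtype_val

theorem top_simplexMap (f : Tot X n) (p : Fin (n + 1))
    (θ : SimplexCategory.mk p.1 ⟶ SimplexCategory.mk n) (t : stdSimplex ℝ (Fin (p.1 + 1))) :
    f.top (simplexMap θ t) = X.map θ (f.1 p t) :=
  f.2 p (Fin.last n) θ t

theorem apply_simplexMap (f : Tot X n) (p : Fin (n + 1))
    (θ : SimplexCategory.mk n ⟶ SimplexCategory.mk p.1) (t : stdSimplex ℝ (Fin (n + 1))) :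
    f.1 p (simplexMap θ t) = X.map θ (f.top t) :=
  f.2 (Fin.last n) p θ t

/-- The value prescribed on the `i`-th face by a point of `Tot^n`. -/
def face (f : Tot X n) (i : Fin (n + 2)) (t : stdSimplex ℝ (Fin (n + 2))) :
    X.obj (SimplexCategory.mk (n + 1)) :=
  X.δ i (f.top (simplexMap (faceRetraction i) t))

/-- Since φ misses i it factors through `δ i`, and the chosen retraction cancels; the prescribed
value is thus independent of that choice. -/
theorem face_eq (f : Tot X n) {i : Fin (n + 2)} (r : Fin (n + 1))
    (φ : SimplexCategory.mk r.1 ⟶ SimplexCategory.mk (n + 1)) (u : stdSimplex ℝ (Fin (r.1 + 1)))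
    (h : ∀ k, φ.toOrderHom k ≠ i) : f.face i (simplexMap φ u) = X.map φ (f.1 r u) := by
  obtain ⟨ψ, rfl⟩ := SimplexCategory.eq_comp_δ_of_not_surjective' φ i h
  rw [face, ← simplexMap_comp, Category.assoc, δ_faceRetraction, Category.comp_id, top_simplexMap,
    X.map_comp]
  rfl

theorem face_eq_face (f : Tot X n) {i k : Fin (n + 2)} {t : stdSimplex ℝ (Fin (n + 2))}
    (hi : t i = 0) (hk : t k = 0) : f.face i t = f.face k t := by
  obtain ⟨r, φ, u, rfl, hφ⟩ := exists_support t ⟨i, hi⟩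
  rw [face_eq f r φ u fun l hl => hφ l (hl ▸ hi), face_eq f r φ u fun l hl => hφ l (hl ▸ hk)]

/-- The values prescribed on the codegeneracies by a point of `Tot^n`. -/
def matching : (n : ℕ) → (f : Tot X n) → (t : stdSimplex ℝ (Fin (n + 2))) → matchingSet X n
  | 0, f, t => ⟨fun i => f.top (simplexMap (SimplexCategory.σ i) t), trivial⟩
  | n + 1, f, t => ⟨fun i => f.top (simplexMap (SimplexCategory.σ i) t), fun i k h => by
      have e : ∀ l : Fin (n + 1), ∀ s, X.σ l (f.top s) =
          f.1 (Fin.last n).castSucc (simplexMap (SimplexCategory.σ l) s) := fun l s =>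
        (f.apply_simplexMap (Fin.last n).castSucc (SimplexCategory.σ l) s).symm
      rw [e, e, ← simplexMap_comp, ← simplexMap_comp, SimplexCategory.σ_comp_σ h]⟩

theorem matching_apply (f : Tot X n) (t : stdSimplex ℝ (Fin (n + 2))) (i : Fin (n + 1)) :
    (matching n f t).1 i = f.top (simplexMap (SimplexCategory.σ i) t) := by
  cases n <;> rfl

theorem continuous_matching :
    Continuous fun z : Tot X n × stdSimplex ℝ (Fin (n + 2)) => matching n z.1 z.2 := by
  refine continuous_induced_rng.2 (continuous_pi fun i => ?_)
  simp only [Function.comp_apply, matching_apply]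
  exact Continuous.eval (continuous_top.comp continuous_fst)
    ((continuous_simplexMap _).comp continuous_snd)

/-- The compatibility of a map in degree `n + 1` with a point of `Tot^n`. -/
structure IsExtension (f : Tot X n)
    (g : C(stdSimplex ℝ (Fin (n + 2)), X.obj (SimplexCategory.mk (n + 1)))) : Prop where
  face : ∀ t i, t i = 0 → g t = f.face i t
  matching : ∀ t, matchingMap X n (g t) = matching n f t

/-- For degree reasons θ cannot be surjective, so its image lies in a face, where g is prescribed.
-/
theorem IsExtension.apply_simplexMap {f : Tot X n}
    {g : C(stdSimplex ℝ (Fin (n + 2)), X.obj (SimplexCategory.mk (n + 1)))}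
    (h : f.IsExtension g) (p : Fin (n + 1))
    (θ : SimplexCategory.mk p.1 ⟶ SimplexCategory.mk (n + 1)) (t : stdSimplex ℝ (Fin (p.1 + 1))) :
    g (simplexMap θ t) = X.map θ (f.1 p t) := by
  have hθ : ¬ Function.Surjective θ.toOrderHom := fun hθ => by
    have := Fintype.card_le_of_surjective _ hθ
    simp at this
    omega
  obtain ⟨i, hi⟩ := not_forall.1 hθ
  have hi' : ∀ k, θ.toOrderHom k ≠ i := fun k hk => hi ⟨k, hk⟩
  rw [h.face _ i (simplexMap_apply_eq_zero t hi'), f.face_eq p θ t hi']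

theorem IsExtension.σ_apply {f : Tot X n}
    {g : C(stdSimplex ℝ (Fin (n + 2)), X.obj (SimplexCategory.mk (n + 1)))}
    (h : f.IsExtension g) (i : Fin (n + 1)) (t : stdSimplex ℝ (Fin (n + 2))) :
    X.σ i (g t) = f.top (simplexMap (SimplexCategory.σ i) t) := by
  rw [← matching_apply, ← h.matching]
  rfl

/-- The components of the point of `Tot^{n+1}` given by a point of `Tot^n` and an extension. -/
def extendFun (f : Tot X n)
    (g : C(stdSimplex ℝ (Fin (n + 2)), X.obj (SimplexCategory.mk (n + 1)))) :
    ∀ p : Fin (n + 2), C(stdSimplex ℝ (Fin (p.val + 1)), X.obj (SimplexCategory.mk p.val)) :=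
  Fin.lastCases (motive := fun p => C(stdSimplex ℝ (Fin (p.val + 1)),
    X.obj (SimplexCategory.mk p.val))) g fun p => f.1 p

theorem extendFun_last (f : Tot X n)
    (g : C(stdSimplex ℝ (Fin (n + 2)), X.obj (SimplexCategory.mk (n + 1)))) :
    extendFun f g (Fin.last (n + 1)) = g :=
  Fin.lastCases_last ..

theorem extendFun_castSucc (f : Tot X n)
    (g : C(stdSimplex ℝ (Fin (n + 2)), X.obj (SimplexCategory.mk (n + 1)))) (p : Fin (n + 1)) :
    extendFun f g p.castSucc = f.1 p :=
  Fin.lastCases_castSucc (motive := fun p => C(stdSimplex ℝ (Fin (p.val + 1)),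
    X.obj (SimplexCategory.mk p.val))) p

/-- Maps from degree at most n into degree n + 1 fall under the face condition. A map out of degree
n + 1 is either injective, hence an identity, or factors through a codegeneracy, and then the
matching condition expresses its value through f. -/
theorem extendFun_naturality {f : Tot X n}
    {g : C(stdSimplex ℝ (Fin (n + 2)), X.obj (SimplexCategory.mk (n + 1)))}
    (h : f.IsExtension g) (p q : Fin (n + 2))
    (θ : SimplexCategory.mk p.val ⟶ SimplexCategory.mk q.val)
    (t : stdSimplex ℝ (Fin (p.val + 1))) :
    extendFun f g q (simplexMap θ t) = X.map θ (extendFun f g p t) := by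
  induction p using Fin.lastCases with
  | cast p =>
    refine Eq.trans ?_ (congrArg (X.map θ) (DFunLike.congr_fun (extendFun_castSucc f g p) t)).symm
    induction q using Fin.lastCases with
    | cast q => exact (DFunLike.congr_fun (extendFun_castSucc f g q) _).trans (f.2 p q θ t)
    | last => exact (DFunLike.congr_fun (extendFun_last f g) _).trans (h.apply_simplexMap p θ t)
  | last =>
    refine Eq.trans ?_ (congrArg (X.map θ) (DFunLike.congr_fun (extendFun_last f g) t)).symm
    by_cases hθ : Function.Injective θ.toOrderHom
    · induction q using Fin.lastCases with
      | cast q =>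
        have := Fintype.card_le_of_injective _ hθ
        simp at this
        omega
      | last =>
        have : Mono θ := SimplexCategory.mono_iff_injective.2 hθ
        obtain rfl : θ = 𝟙 _ := SimplexCategory.eq_id_of_mono θ
        refine (DFunLike.congr_fun (extendFun_last f g) _).trans ?_
        refine (congrArg g (simplexMap_id t)).trans ?_
        exact (ConcreteCategory.congr_hom (X.map_id _) (g t)).symm
    · obtain ⟨i, θ', rfl⟩ : ∃ (i : Fin (n + 1))
          (θ' : SimplexCategory.mk n ⟶ SimplexCategory.mk q.1), θ = SimplexCategory.σ i ≫ θ' :=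
        SimplexCategory.eq_σ_comp_of_not_injective (n := n) θ hθ
      have e : X.map (SimplexCategory.σ i ≫ θ') (g t) =
          X.map θ' (f.top (simplexMap (SimplexCategory.σ i) t)) := by
        rw [← h.σ_apply, X.map_comp]
        rfl
      refine Eq.trans ?_ e.symm
      refine (congrArg (extendFun f g q) (simplexMap_comp (SimplexCategory.σ i) θ' t)).trans ?_
      induction q using Fin.lastCases with
      | cast q =>
        exact (DFunLike.congr_fun (extendFun_castSucc f g q) _).trans (f.apply_simplexMap q θ' _)
      | last =>
        exact (DFunLike.congr_fun (extendFun_last f g) _).trans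
          (h.apply_simplexMap (Fin.last n) θ' _)

/-- The point of `Tot^{n+1}` given by a point of `Tot^n` and an extension. -/
def extend (f : Tot X n)
    (g : C(stdSimplex ℝ (Fin (n + 2)), X.obj (SimplexCategory.mk (n + 1))))
    (h : f.IsExtension g) : Tot X (n + 1) :=
  ⟨extendFun f g, extendFun_naturality h⟩

theorem totRestrict_extend (f : Tot X n)
    (g : C(stdSimplex ℝ (Fin (n + 2)), X.obj (SimplexCategory.mk (n + 1))))
    (h : f.IsExtension g) : totRestrict X n (f.extend g h) = f :=
  Subtype.ext (funext fun p => extendFun_castSucc f g p)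

theorem top_extend (f : Tot X n)
    (g : C(stdSimplex ℝ (Fin (n + 2)), X.obj (SimplexCategory.mk (n + 1))))
    (h : f.IsExtension g) : (f.extend g h).top = g :=
  extendFun_last f g

theorem ext_of_top {f g : Tot X (n + 1)} (h : totRestrict X n f = totRestrict X n g)
    (h' : f.top = g.top) : f = g := by
  refine Subtype.ext (funext fun p => ?_)
  induction p using Fin.lastCases with
  | cast p => exact congrFun (congrArg Subtype.val h) p
  | last => exact h'

theorem continuous_extend {Y : Type*} [TopologicalSpace Y] {f : Y → Tot X n}
    {g : Y → C(stdSimplex ℝ (Fin (n + 2)), X.obj (SimplexCategory.mk (n + 1)))}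
    (hf : Continuous f) (hg : Continuous g) (h : ∀ y, (f y).IsExtension (g y)) :
    Continuous fun y => (f y).extend (g y) (h y) := by
  refine Continuous.subtype_mk (continuous_pi fun p => ?_) _
  induction p using Fin.lastCases with
  | cast p =>
    simp only [extendFun_castSucc]
    exact (continuous_apply p).comp (continuous_subtype_val.comp hf)
  | last => simpa only [extendFun_last] using hg

theorem isExtension_top (f : Tot X (n + 1)) : (totRestrict X n f).IsExtension f.top where
  face t i h := by
    conv_lhs => rw [← simplexMap_faceRetraction h]
    exact f.top_simplexMap (Fin.last n).castSucc (SimplexCategory.δ i) _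
  matching t := by
    refine Subtype.ext (funext fun i => ?_)
    rw [matching_apply]
    exact (f.apply_simplexMap (Fin.last n).castSucc (SimplexCategory.σ i) t).symm

end Tot

end Tower

/-! ### The layers as iterated loop spaces of fibers of matching maps -/

section Layers

variable {X : CosimplicialObject TopCat.{u}} {n : ℕ}

theorem Tot.continuous_face (i : Fin (n + 2)) :
    Continuous fun z : Tot X n × stdSimplex ℝ (Fin (n + 2)) => z.1.face i z.2 :=
  (X.δ i).hom.continuous.comp (Continuous.eval (Tot.continuous_top.comp continuous_fst)
    ((continuous_simplexMap _).comp continuous_snd))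

/-- The two prescriptions for an extension are consistent: on the support of t both are values of
structure maps of X on a lower component of f. -/
theorem Tot.matchingMap_face (f : Tot X n) {i : Fin (n + 2)} {t : stdSimplex ℝ (Fin (n + 2))}
    (h : t i = 0) : matchingMap X n (f.face i t) = f.matching n t := by
  obtain ⟨r, φ, v, rfl, hφ⟩ := exists_support t ⟨i, h⟩
  refine Subtype.ext (funext fun k => ?_)
  rw [matching_apply, f.face_eq r φ v fun l hl => hφ l (hl ▸ h), ← simplexMap_comp,
    top_simplexMap, X.map_comp]
  rfl

theorem continuous_simplex_coord (i : Fin (n + 1)) :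
    Continuous fun t : stdSimplex ℝ (Fin (n + 1)) => t i :=
  (continuous_apply i).comp continuous_subtype_val

/-- Only the top component has to be lifted. It is a map on I^m × I × Δ^{n+1}, prescribed at time 0
by g, on the boundary of the simplex by the faces of H, and in the matching space everywhere. This
is a box lifting problem against the matching map. -/
theorem IsFibrant.isSerreFibration_totRestrict (hX : IsFibrant X) (n : ℕ) :
    IsSerreFibration (totRestrict X n) := by
  intro m H g hg
  obtain ⟨e, he⟩ := exists_cube_homeo_simplex n
  let e' : ((Fin m → I) × I) × (Fin (n + 1) → I) ≃ₜ ((Fin m ⊕ Unit) ⊕ Fin (n + 1) → I) :=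
    ((cubeProdI (Fin m)).prodCongr (.refl _)).trans (cubeProd _ _)
  let D : Set ((Fin m ⊕ Unit) ⊕ Fin (n + 1)) := Set.range .inr
  let E : Set ((Fin m ⊕ Unit) ⊕ Fin (n + 1)) := {.inl (.inr ())}
  have hDE : Disjoint D E := by simp [D, E]
  have hbox : ∀ z, e' z ∈ box D E ↔ z.1.2 = 0 ∨ ∃ i, e z.2 i = 0 := by
    intro z
    rw [← he]
    constructor
    · rintro (⟨_, ⟨i, rfl⟩, h⟩ | ⟨_, rfl, h⟩)
      · exact .inr ⟨i, h⟩
      · exact .inl h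
    · rintro (h | ⟨i, h⟩)
      · exact .inr ⟨_, rfl, h⟩
      · exact .inl ⟨_, ⟨i, rfl⟩, h⟩
  have hext : ∀ x, (H (x, 0)).IsExtension (g x).top := fun x => by
    rw [← hg]; exact (g x).isExtension_top
  have : Nonempty (X.obj (SimplexCategory.mk (n + 1))) := ⟨(g 0).top (e 0)⟩
  obtain ⟨d, hd, hd'⟩ := exists_continuousOn_glue
    (Y := ((Fin m → I) × I) × (Fin (n + 1) → I)) (Z := X.obj (SimplexCategory.mk (n + 1)))
    (T := Option (Fin (n + 2)))
    (fun k => k.elim {z | z.1.2 = 0} fun i => {z | e z.2 i = 0})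
    (fun k => k.elim (fun z => (g z.1.1).top (e z.2)) fun i z => (H z.1).face i (e z.2))
    (by
      rintro (_ | i)
      · exact isClosed_eq (continuous_snd.comp continuous_fst) continuous_const
      · exact isClosed_eq ((continuous_simplex_coord i).comp
          (e.continuous.comp continuous_snd)) continuous_const)
    (by
      rintro (_ | i)
      · exact (Continuous.eval (Tot.continuous_top.comp
          (g.continuous.comp (continuous_fst.comp continuous_fst)))
          (e.continuous.comp continuous_snd)).continuousOn
      · exact ((Tot.continuous_face i).comp ((H.continuous.comp continuous_fst).prodMk
          (e.continuous.comp continuous_snd))).continuousOn)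
    (by
      rintro (_ | i) (_ | k) ⟨⟨x, t⟩, y⟩ h h'
      · rfl
      · obtain rfl : t = 0 := h
        exact (hext x).face _ k h'
      · obtain rfl : t = 0 := h'
        exact ((hext x).face _ i h).symm
      · exact Tot.face_eq_face _ h h')
  have hd0 : ∀ z, z.1.2 = 0 → d z = (g z.1.1).top (e z.2) := fun z hz => hd' none z hz
  have hdi : ∀ i z, e z.2 i = 0 → d z = (H z.1).face i (e z.2) := fun i z hz => hd' (some i) z hz
  obtain ⟨l, hl, hpl⟩ := (hX n).exists_box_lift e' hDE (Set.singleton_nonempty _) d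
    (hd.mono fun z hz => by
      rcases (hbox z).1 hz with hz | ⟨i, hz⟩
      · exact Set.mem_iUnion.2 ⟨none, hz⟩
      · exact Set.mem_iUnion.2 ⟨some i, hz⟩)
    ⟨fun z => (H z.1).matching n (e z.2), Tot.continuous_matching.comp
      ((H.continuous.comp continuous_fst).prodMk (e.continuous.comp continuous_snd))⟩ (by
      rintro ⟨⟨x, t⟩, y⟩ hz
      rcases (hbox _).1 hz with hz | ⟨i, hz⟩
      · rw [hd0 _ hz]
        obtain rfl : t = 0 := hz
        exact (hext x).matching _
      · rw [hdi i _ hz]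
        exact Tot.matchingMap_face _ hz)
  let G' : (Fin m → I) × I → C(stdSimplex ℝ (Fin (n + 2)), X.obj (SimplexCategory.mk (n + 1))) :=
    fun z => (l.curry z).comp ⟨e.symm, e.symm.continuous⟩
  have hG' : ∀ z, (H z).IsExtension (G' z) := fun z => by
    refine ⟨fun t i h => ?_, fun t => ?_⟩
    · have h' : e (e.symm t) i = 0 := by rwa [e.apply_symm_apply]
      refine (hl (z, e.symm t) ((hbox _).2 (.inr ⟨i, h'⟩))).trans ((hdi i _ h').trans ?_)
      simp only [e.apply_symm_apply]
    · refine (hpl (z, e.symm t)).trans ?_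
      simp only [ContinuousMap.coe_mk, e.apply_symm_apply]
  refine ⟨⟨fun z => (H z).extend (G' z) (hG' z), Tot.continuous_extend H.continuous
    ((ContinuousMap.continuous_precomp _).comp l.curry.continuous) hG'⟩, fun x => ?_, fun z => ?_⟩
  · refine Tot.ext_of_top ((Tot.totRestrict_extend _ _ (hG' (x, 0))).trans (hg x).symm) ?_
    refine (Tot.top_extend _ _ (hG' (x, 0))).trans (ContinuousMap.ext fun t => ?_)
    refine (hl ((x, 0), e.symm t) ((hbox _).2 (.inl rfl))).trans ((hd0 _ rfl).trans ?_)
    simp only [e.apply_symm_apply]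
  · exact Tot.totRestrict_extend _ _ (hG' z)

/-- Two extensions of f have the same boundary values and the same matching values, so taking top
components is a homeomorphism with inverse `Tot.extend`. -/
theorem Fiber.weaklyEquivalent_relSections {f : Tot X n} (y₀ : Fiber (totRestrict X n) f)
    (e : (Fin (n + 1) → I) ≃ₜ stdSimplex ℝ (Fin (n + 2)))
    (he : ∀ y, y ∈ Cube.boundary (Fin (n + 1)) ↔ ∃ i, e y i = 0) :
    WeaklyEquivalent (Fiber (totRestrict X n) f)
      (RelSections (matchingMap X n) (y₀.1.top.comp ⟨e, e.continuous⟩)) := by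
  have hext : ∀ y : Fiber (totRestrict X n) f, f.IsExtension y.1.top := fun y => by
    have := y.1.isExtension_top
    rwa [y.2] at this
  let F : C(Fiber (totRestrict X n) f,
      RelSections (matchingMap X n) (y₀.1.top.comp ⟨e, e.continuous⟩)) :=
    ⟨fun y => ⟨y.1.top.comp ⟨e, e.continuous⟩,
      fun _ => ((hext y).matching _).trans ((hext y₀).matching _).symm, fun x hx => by
        obtain ⟨i, hi⟩ := (he x).1 hx
        exact ((hext y).face _ i hi).trans ((hext y₀).face _ i hi).symm⟩,
      ((ContinuousMap.continuous_precomp _).comp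
        (Tot.continuous_top.comp continuous_subtype_val)).subtype_mk _⟩
  have hs : ∀ s : RelSections (matchingMap X n) (y₀.1.top.comp ⟨e, e.continuous⟩),
      f.IsExtension (s.1.comp ⟨e.symm, e.symm.continuous⟩) := fun s => by
    refine ⟨fun t i h => ?_, fun t => ?_⟩
    · have h' : ∃ i, e (e.symm t) i = 0 := ⟨i, by rwa [e.apply_symm_apply]⟩
      refine (s.2.2 _ ((he _).2 h')).trans (Eq.trans ?_ ((hext y₀).face t i h))
      exact congrArg y₀.1.top (e.apply_symm_apply t)
    · refine (s.2.1 _).trans (Eq.trans ?_ ((hext y₀).matching t))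
      exact congrArg (fun t => matchingMap X n (y₀.1.top t)) (e.apply_symm_apply t)
  let G : C(RelSections (matchingMap X n) (y₀.1.top.comp ⟨e, e.continuous⟩),
      Fiber (totRestrict X n) f) :=
    ⟨fun s => ⟨f.extend _ (hs s), Tot.totRestrict_extend ..⟩,
      (Tot.continuous_extend continuous_const
        ((ContinuousMap.continuous_precomp _).comp continuous_subtype_val) hs).subtype_mk _⟩
  refine (IsCompressing.of_inverse (f := F) G (fun s => ?_) fun y => ?_).weaklyEquivalent
  · refine Subtype.ext (ContinuousMap.ext fun x => ?_)
    refine (DFunLike.congr_fun (Tot.top_extend f _ (hs s)) (e x)).trans ?_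
    exact congrArg s.1 (e.symm_apply_apply x)
  · refine Subtype.ext (Tot.ext_of_top ((Tot.totRestrict_extend _ _ (hs (F y))).trans y.2.symm) ?_)
    refine (Tot.top_extend f _ (hs (F y))).trans (ContinuousMap.ext fun t => ?_)
    exact congrArg y.1.top (e.apply_symm_apply t)

/-- The layers of the tower of partial totalizations are iterated loop spaces of the fibers of the
matching maps. -/
theorem IsFibrant.weaklyEquivalent_layer (hX : IsFibrant X) {f : Tot X n}
    (hL : Nonempty (Layer X n f)) {b : X.obj (SimplexCategory.mk (n + 1))}
    (hb : b = X.map (SimplexCategory.const (SimplexCategory.mk 0) (SimplexCategory.mk (n + 1)) 0)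
      f.point) :
    WeaklyEquivalent (Layer X n f)
      (GenLoop (Fin (n + 1)) (Fiber (matchingMap X n) (matchingMap X n b)) ⟨b, rfl⟩) := by
  have hfib := (hX.isSerreFibration_totRestrict n).isCompressing_fiberInclusion f
  obtain ⟨y₀⟩ := hfib.nonempty hL
  obtain ⟨e, he⟩ := exists_cube_homeo_simplex n
  have hext : f.IsExtension y₀.1.top := by
    have := y₀.1.isExtension_top
    rwa [y₀.2] at this
  have h := hext.apply_simplexMap 0
    (SimplexCategory.const (SimplexCategory.mk 0) (SimplexCategory.mk (n + 1)) 0)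
    (stdSimplex.vertex 0)
  -- The contraction point is the one over the vertex 0: there every extension of f takes the value
  -- b, so the loop space acquires the required base point.
  obtain ⟨x₀, hx₀⟩ := e.surjective (simplexMap (SimplexCategory.const (SimplexCategory.mk 0)
    (SimplexCategory.mk (n + 1)) 0) (stdSimplex.vertex 0))
  obtain rfl : (y₀.1.top.comp ⟨e, e.continuous⟩) x₀ = b := by
    refine Eq.trans ?_ (h.trans hb.symm)
    exact congrArg y₀.1.top hx₀
  refine .trans _ _ _ (.symm _ _ hfib.weaklyEquivalent) ?_
  refine .trans _ _ _ (Fiber.weaklyEquivalent_relSections y₀ e he) ?_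
  exact (hX n).weaklyEquivalent_relSections _ x₀

end Layers

/-! ### The cube of codegeneracies -/

section Codegeneracies

theorem σ_apply_val {m : ℕ} (k : Fin (m + 1)) (p : Fin (m + 2)) :
    ((SimplexCategory.σ k).toOrderHom p : Fin (m + 1)).val =
      if p.val < k.val + 1 then p.val else p.val - 1 := by
  change (Fin.predAbove k p).val = _
  unfold Fin.predAbove
  split_ifs with h1 h2 h2 <;> simp [Fin.lt_def] at h1 ⊢ <;> omega

theorem eq_σ_of_val {m : ℕ} (k : Fin (m + 1))
    (f : SimplexCategory.mk (m + 1) ⟶ SimplexCategory.mk m)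
    (h : ∀ p : Fin (m + 2), (f.toOrderHom p : Fin (m + 1)).val =
      if p.val < k.val + 1 then p.val else p.val - 1) : f = SimplexCategory.σ k := by
  ext p : 3
  exact Fin.ext ((h p).trans (σ_apply_val k p).symm)

variable {X : CosimplicialObject TopCat.{u}}

theorem isSerreFibration_punit (A : Type u) [TopologicalSpace A] :
    IsSerreFibration (ContinuousMap.const A (PUnit.unit : PUnit.{u + 1})) :=
  fun _ _ g _ => ⟨g.comp .fst, fun _ => rfl, fun _ => rfl⟩

/-- A form of fibrancy in which the codegeneracies are only recognized by their values. -/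
theorem IsFibrant.exists_box_lift_of_codegeneracies (hX : IsFibrant X) {m : ℕ}
    {a : SimplexCategory} (ha : a.len = m + 1) {b : Fin (m + 1) → SimplexCategory}
    (hb : ∀ k, (b k).len = m) (f : ∀ k, a ⟶ b k)
    (hf : ∀ k p, ((f k).toOrderHom p).val = if p.val < k.val + 1 then p.val else p.val - 1)
    {N K : Type} [Finite N] [TopologicalSpace K] (e : K ≃ₜ (N → I)) {D E : Set N}
    (hDE : Disjoint D E) (hE : E.Nonempty) (l₀ : K → X.obj a)
    (hl₀ : ContinuousOn l₀ (e ⁻¹' box D E)) (θ : ∀ k, C(K, X.obj (b k)))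
    (hθ : ∀ i k, i < k → ∃ (c : SimplexCategory) (g : b k ⟶ c) (h : b i ⟶ c), c.len + 1 = m ∧
      (∀ p, (g.toOrderHom p).val = if p.val < i.val + 1 then p.val else p.val - 1) ∧
      (∀ p, (h.toOrderHom p).val = if p.val < k.val then p.val else p.val - 1) ∧
        ∀ x, X.map g (θ k x) = X.map h (θ i x))
    (hlθ : ∀ x, e x ∈ box D E → ∀ k, X.map (f k) (l₀ x) = θ k x) :
    ∃ l : C(K, X.obj a), (∀ x, e x ∈ box D E → l x = l₀ x) ∧
      ∀ k x, X.map (f k) (l x) = θ k x := by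
  obtain rfl : a = SimplexCategory.mk (m + 1) := SimplexCategory.ext ha
  obtain rfl : b = fun _ => SimplexCategory.mk m :=
    funext fun k => SimplexCategory.ext (hb k)
  obtain rfl : f = fun k => SimplexCategory.σ k := funext fun k => eq_σ_of_val k _ (hf k)
  have hmem : ∀ x, (fun k => θ k x) ∈ matchingSet X m := by
    intro x
    cases m with
    | zero => trivial
    | succ m =>
      intro i k hik
      -- A matching relation for i ≤ k compares the codegeneracies numbered i and k + 1, a strictly
      -- increasing pair.
      obtain ⟨c, g, h, hc, hg, hh, hgh⟩ := hθ i.castSucc k.succ (Nat.lt_succ_of_le hik)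
      obtain rfl : c = SimplexCategory.mk m := SimplexCategory.ext (Nat.succ_injective hc)
      obtain rfl := eq_σ_of_val i g hg
      obtain rfl := eq_σ_of_val k h hh
      exact hgh x
  obtain ⟨l, hl, hl'⟩ := (hX m).exists_box_lift e hDE hE l₀ hl₀
    ⟨fun x => ⟨fun k => θ k x, hmem x⟩,
      Continuous.subtype_mk (continuous_pi fun k => (θ k).continuous) _⟩
    fun x hx => Subtype.ext (funext fun k => hlθ x hx k)
  exact ⟨l, hl, fun k x => congrFun (congrArg Subtype.val (hl' x)) k⟩

variable {j : ℕ}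

theorem card_filter_le_remainingIso (S : Finset (Fin j)) (p : Fin (j - S.card + 1)) :
    ((remaining S).filter (· ≤ (remainingIso S p).1)).card = p.val + 1 := by
  have : (remaining S).filter (· ≤ (remainingIso S p).1) =
      (Finset.Iic p).map ((remainingIso S).toEquiv.toEmbedding.trans (.subtype _)) := by
    ext y
    simp only [Finset.mem_filter, Finset.mem_map, Finset.mem_Iic]
    constructor
    · rintro ⟨hy, h⟩
      refine ⟨(remainingIso S).symm ⟨y, hy⟩, ?_, by simp⟩
      rw [OrderIso.symm_apply_le]
      exact h
    · rintro ⟨q, hq, rfl⟩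
      exact ⟨(remainingIso S q).2, (remainingIso S).monotone hq⟩
  rw [this, Finset.card_map, Fin.card_Iic]

theorem card_filter_lt_remainingIso (S : Finset (Fin j)) (p : Fin (j - S.card + 1)) :
    ((remaining S).filter (· < (remainingIso S p).1)).card = p.val := by
  have h := card_filter_le_remainingIso S p
  have h' : (remaining S).filter (· ≤ (remainingIso S p).1) =
      insert (remainingIso S p).1 ((remaining S).filter (· < (remainingIso S p).1)) := by
    ext y
    simp only [Finset.mem_filter, Finset.mem_insert, le_iff_lt_or_eq]
    constructor
    · rintro ⟨hy, h | h⟩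
      · exact .inr ⟨hy, h⟩
      · exact .inl h
    · rintro (rfl | ⟨hy, h⟩)
      · exact ⟨(remainingIso S p).2, .inr rfl⟩
      · exact ⟨hy, .inl h⟩
  rw [h', Finset.card_insert_of_notMem (by simp)] at h
  omega

theorem remainingIso_symm_floor_val (S : Finset (Fin j)) (x : Fin (j + 1)) :
    ((remainingIso S).symm (floor S x)).val + 1 = ((remaining S).filter (· ≤ x)).card := by
  rw [← card_filter_le_remainingIso, OrderIso.apply_symm_apply]
  congr 1
  ext y
  simp only [Finset.mem_filter, and_congr_right_iff]
  exact fun hy => ⟨fun h => h.trans (floor_le S x), fun h => le_floor hy h⟩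

theorem mem_remaining_succ {S : Finset (Fin j)} {i : Fin j} : i.succ ∈ remaining S ↔ i ∉ S := by
  simp [remaining]

theorem remaining_insert (S : Finset (Fin j)) (i : Fin j) :
    remaining (insert i S) = (remaining S).erase i.succ := by
  ext y
  simp [remaining, eq_comm]

/-- Positions are counts of smaller remaining elements. Deleting the element at position r lowers
the count by one from that position on, which is the codegeneracy of index r - 1. -/
theorem cShriek_map_insert_val {S S' : Finset (Fin j)} (h : S ≤ S') {i : Fin j} (hi : i ∉ S)
    (hS' : S' = insert i S) {r : ℕ}
    (hr : ((remaining S).filter (· < i.succ)).card = r) (p : Fin (j - S.card + 1)) :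
    ((((cShriek j).map (homOfLE h)).toOrderHom p : Fin (j - S'.card + 1))).val =
      if p.val < r then p.val else p.val - 1 := by
  subst hS' hr
  have h1 := remainingIso_symm_floor_val (insert i S) (remainingIso S p).1
  have h2 := card_filter_le_remainingIso S p
  have hmem := mem_remaining_succ.2 hi
  change ((remainingIso (insert i S)).symm (floor (insert i S) (remainingIso S p).1)).val = _
  have h4 : (remaining (insert i S)).filter (· ≤ (remainingIso S p).1) =
      ((remaining S).filter (· ≤ (remainingIso S p).1)).erase i.succ := by
    rw [remaining_insert, Finset.filter_erase]
  rw [h4] at h1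
  have h3 : (remainingIso S p).1 < i.succ ↔ p.val < ((remaining S).filter (· < i.succ)).card := by
    constructor
    · intro hlt
      have : ((remaining S).filter (· ≤ (remainingIso S p).1)).card ≤
          ((remaining S).filter (· < i.succ)).card :=
        Finset.card_le_card (Finset.monotone_filter_right _ fun y _ hy => lt_of_le_of_lt hy hlt)
      omega
    · intro hlt
      by_contra hle
      have : ((remaining S).filter (· < i.succ)).card ≤
          ((remaining S).filter (· < (remainingIso S p).1)).card :=
        Finset.card_le_card (Finset.monotone_filter_right _
          fun y _ hy => lt_of_lt_of_le hy (not_lt.1 hle))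
      rw [card_filter_lt_remainingIso] at this
      omega
  split_ifs with hp
  · rw [← h3] at hp
    rw [Finset.erase_eq_of_notMem (by simp [hp])] at h1
    omega
  · rw [← h3, not_lt] at hp
    rw [Finset.card_erase_of_mem (by simp [hp, hmem])] at h1
    omega

/-- Fibrancy of `X` as a lifting property for the maps out of a vertex of the cube. -/
theorem IsFibrant.exists_box_lift_shriekCube (hX : IsFibrant X) (S : Finset (Fin j))
    {N K : Type} [Finite N] [TopologicalSpace K] (e : K ≃ₜ (N → I)) {D E : Set N}
    (hDE : Disjoint D E) (hE : E.Nonempty) (l₀ : K → (shriekCube X j).obj S)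
    (hl₀ : ContinuousOn l₀ (e ⁻¹' box D E)) (θ : ∀ i, C(K, (shriekCube X j).obj (insert i S)))
    (hθ : ∀ i k U (hi : insert i S ≤ U) (hk : insert k S ≤ U), i ∉ S → k ∉ S → ∀ x,
      (shriekCube X j).map (homOfLE hi) (θ i x) = (shriekCube X j).map (homOfLE hk) (θ k x))
    (hlθ : ∀ x, e x ∈ box D E → ∀ i, i ∉ S →
      (shriekCube X j).map (homOfLE (Finset.subset_insert i S)) (l₀ x) = θ i x) :
    ∃ l : C(K, (shriekCube X j).obj S), (∀ x, e x ∈ box D E → l x = l₀ x) ∧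
      ∀ i, i ∉ S → ∀ x,
        (shriekCube X j).map (homOfLE (Finset.subset_insert i S)) (l x) = θ i x := by
  obtain hS | ⟨m, hm⟩ : S = Finset.univ ∨ ∃ m, j - S.card = m + 1 := by
    by_cases hS : S = Finset.univ
    · exact .inl hS
    · have := (Finset.card_lt_iff_ne_univ S).2 hS
      rw [Fintype.card_fin] at this
      exact .inr ⟨j - S.card - 1, by omega⟩
  -- The terminal vertex has no maps to larger ones, and every space is fibrant over a point.
  · obtain ⟨l, hl, -⟩ := (isSerreFibration_punit _).exists_box_lift e hDE hE l₀ hl₀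
      (.const _ PUnit.unit) fun _ _ => rfl
    exact ⟨l, hl, fun i hi => (hi (hS ▸ Finset.mem_univ i)).elim⟩
  -- The element 0 always remains, so the deletable elements occupy the positions k + 1. Thus ι
  -- lists the complement of S in increasing order, and deleting ι k induces the k-th codegeneracy.
  · let q : Fin (m + 1) → Fin (j - S.card + 1) := fun k => ⟨k.val + 1, by omega⟩
    have hq0 : ∀ k, (remainingIso S (q k)).1 ≠ 0 := fun k h => by
      have := card_filter_lt_remainingIso S (q k)
      rw [h] at this
      simp [q] at this
    let ι : Fin (m + 1) → Fin j := fun k => (remainingIso S (q k)).1.pred (hq0 k)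
    have hι : ∀ k, (ι k).succ = (remainingIso S (q k)).1 := fun k => Fin.succ_pred _ _
    have hιS : ∀ k, ι k ∉ S := fun k => by
      rw [← mem_remaining_succ, hι]
      exact (remainingIso S (q k)).2
    have hιrank : ∀ k, ((remaining S).filter (· < (ι k).succ)).card = k.val + 1 := fun k => by
      rw [hι, card_filter_lt_remainingIso]
    have hιlt : ∀ i k, i < k → ι i < ι k := fun i k hik => by
      rw [← Fin.succ_lt_succ_iff, hι, hι]
      exact (remainingIso S).strictMono (Nat.succ_lt_succ hik)
    have hιsurj : ∀ i, i ∉ S → ∃ k, ι k = i := fun i hi => by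
      let y : remaining S := ⟨i.succ, mem_remaining_succ.2 hi⟩
      have hy : ((remainingIso S).symm y).val ≠ 0 := fun h => by
        have h' := card_filter_lt_remainingIso S ((remainingIso S).symm y)
        rw [OrderIso.apply_symm_apply, h, Finset.card_eq_zero,
          Finset.filter_eq_empty_iff] at h'
        exact h' (zero_mem_remaining S) (Fin.succ_pos i)
      refine ⟨⟨((remainingIso S).symm y).val - 1, by omega⟩, Fin.succ_injective _ ?_⟩
      rw [hι]
      have : q ⟨((remainingIso S).symm y).val - 1, by omega⟩ = (remainingIso S).symm y :=
        Fin.ext (by simp only [q]; omega)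
      rw [this, OrderIso.apply_symm_apply]
    have hcard : ∀ k, j - (insert (ι k) S).card = m := fun k => by
      rw [Finset.card_insert_of_notMem (hιS k)]
      omega
    obtain ⟨l, hl, hl'⟩ := hX.exists_box_lift_of_codegeneracies (m := m)
      (a := (cShriek j).obj S) hm (b := fun k => (cShriek j).obj (insert (ι k) S)) hcard
      (fun k => (cShriek j).map (homOfLE (Finset.subset_insert (ι k) S)))
      (fun k p => cShriek_map_insert_val _ (hιS k) rfl (hιrank k) p)
      e hDE hE l₀ hl₀ (fun k => θ (ι k))
      (fun i k hik => by
        have hne : ι i ≠ ι k := (hιlt i k hik).ne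
        have hi : ι i ∉ insert (ι k) S := by simp [hιS, hne]
        have hk : ι k ∉ insert (ι i) S := by simp [hιS, hne.symm]
        have hU : insert (ι i) (insert (ι k) S) = insert (ι k) (insert (ι i) S) :=
          Finset.insert_comm _ _ _
        refine ⟨(cShriek j).obj (insert (ι i) (insert (ι k) S)),
          (cShriek j).map (homOfLE (Finset.subset_insert _ _)),
          (cShriek j).map (homOfLE (hU ▸ Finset.subset_insert _ _)), ?_,
          cShriek_map_insert_val _ hi rfl ?_, cShriek_map_insert_val _ hk hU ?_,
          fun x => hθ _ _ _ _ _ (hιS k) (hιS i) x⟩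
        · change j - (insert (ι i) (insert (ι k) S)).card + 1 = m
          have h1 := hcard k
          have h2 := Finset.card_le_univ (insert (ι i) (insert (ι k) S))
          rw [Finset.card_insert_of_notMem hi] at h2 ⊢
          rw [Fintype.card_fin] at h2
          omega
        -- Deleting the larger ι k does not affect the position of ι i, whereas below deleting the
        -- smaller ι i shifts ι k down by one.
        · rw [remaining_insert, Finset.filter_erase, Finset.erase_eq_of_notMem, hιrank]
          simp [(hιlt i k hik).le]
        · rw [remaining_insert, Finset.filter_erase, Finset.card_erase_of_mem, hιrank]
          · rfl
          · simp [hιlt i k hik, mem_remaining_succ, hιS])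
      (fun x hx k => hlθ x hx (ι k) (hιS k))
    refine ⟨l, hl, fun i hi x => ?_⟩
    obtain ⟨k, rfl⟩ := hιsurj i hi
    exact hl' k x

end Codegeneracies

/-! ### Total homotopy fibers in cubical coordinates -/

section Truncation

variable {T : Type} [DecidableEq T]

/-- Setting the coordinates outside of `S` equal to `1`. -/
def trunc (S : Finset T) (z : T → I) (i : T) : I := if i ∈ S then z i else 1

theorem continuous_trunc (S : Finset T) : Continuous (trunc S) := by
  refine continuous_pi fun i => ?_
  unfold trunc
  split_ifs <;> fun_prop

theorem trunc_of_le {S S' : Finset T} (h : S ≤ S') (z : T → I) :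
    trunc S' (trunc S z) = trunc S z := by
  funext i
  unfold trunc
  by_cases hi : i ∈ S
  · simp [hi, h hi]
  · simp [hi]

theorem trunc_apply_of_mem {S : Finset T} {i : T} (hi : i ∈ S) (z : T → I) :
    trunc S z i = z i :=
  if_pos hi

theorem trunc_empty (z : T → I) : trunc ∅ z = 1 := by
  funext i
  simp [trunc]

end Truncation

/-! ### The cone on a nerve as a cube -/

section Nerve

variable {T : Type} [Fintype T] [DecidableEq T]

/-- The sum of the barycentric coordinates `w A` over the sets `A` containing `i`. -/
def height (w : {S : Finset T // S.Nonempty} → ℝ) (i : T) : ℝ := ∑ A with i ∈ A.1, w A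

variable {w w' : {S : Finset T // S.Nonempty} → ℝ}

/-- Take i of least height in A. If some B in the chain contained i but missed l in A, every member
of the chain containing l would contain B, hence i, so l would have smaller height. Upper sums of w
are therefore minima of heights. -/
theorem exists_height_eq_sum (h0 : ∀ A, 0 ≤ w A) (hc : IsChain (· ≤ ·) {A | w A ≠ 0})
    (A : {S : Finset T // S.Nonempty}) :
    ∃ i ∈ A.1, height w i = ∑ B with A ≤ B, w B ∧ ∀ l ∈ A.1, height w i ≤ height w l := by
  obtain ⟨i, hi, hmin⟩ := A.1.exists_min_image (height w) A.2
  refine ⟨i, hi, ?_, hmin⟩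
  symm
  refine Finset.sum_subset (Finset.monotone_filter_right _ fun B _ hB => hB hi) ?_
  intro B hB hB'
  simp only [Finset.mem_filter, Finset.mem_univ, true_and] at hB hB'
  by_contra hwB
  obtain ⟨l, hlA, hlB⟩ := Finset.not_subset.1 hB'
  refine (hmin l hlA).not_gt ?_
  have hsub : ∀ C ∈ Finset.univ.filter (fun C : {S : Finset T // S.Nonempty} => l ∈ C.1), w C ≠ 0 →
      C ∈ Finset.univ.filter (fun C : {S : Finset T // S.Nonempty} => i ∈ C.1) := by
    intro C hC hwC
    simp only [Finset.mem_filter, Finset.mem_univ, true_and] at hC ⊢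
    rcases hc.total hwC hwB with h | h
    · exact (hlB (h hC)).elim
    · exact h hB
  rw [height, height, ← Finset.sum_filter_ne_zero]
  refine Finset.sum_lt_sum_of_subset (i := B) (fun C hC => ?_) (by simpa using hB)
    (by simp [hlB]) (lt_of_le_of_ne (h0 B) (Ne.symm hwB)) fun C _ _ => h0 C
  rw [Finset.mem_filter] at hC
  exact hsub C hC.1 hC.2

/-- Heights determine the upper sums, and upper sums determine w: at a largest set where w and w'
differ, all strictly larger terms cancel. -/
theorem eq_of_height_eq (h0 : ∀ A, 0 ≤ w A) (hc : IsChain (· ≤ ·) {A | w A ≠ 0})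
    (h0' : ∀ A, 0 ≤ w' A) (hc' : IsChain (· ≤ ·) {A | w' A ≠ 0})
    (h : height w = height w') : w = w' := by
  have hU : ∀ A, ∑ B with A ≤ B, w B = ∑ B with A ≤ B, w' B := fun A => by
    obtain ⟨i, hi, h1, h2⟩ := exists_height_eq_sum h0 hc A
    obtain ⟨k, hk, h3, h4⟩ := exists_height_eq_sum h0' hc' A
    rw [← h1, ← h3]
    rw [h] at h2 ⊢
    exact le_antisymm (h2 k hk) (h4 i hi)
  by_contra hne
  obtain ⟨A, hA, hmax⟩ := (Finset.univ.filter fun A => w A ≠ w' A).exists_max_image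
    (fun A => A.1.card) (by
      obtain ⟨A, hA⟩ := Function.ne_iff.1 hne
      exact ⟨A, by simpa using hA⟩)
  simp only [Finset.mem_filter, Finset.mem_univ, true_and] at hA hmax
  have hsplit : Finset.univ.filter (fun B => A ≤ B) =
      insert A (Finset.univ.filter fun B => A < B) := by
    ext B
    simp [le_iff_eq_or_lt, eq_comm]
  have hUA := hU A
  rw [hsplit, Finset.sum_insert (by simp), Finset.sum_insert (by simp)] at hUA
  have hs : ∑ B with A < B, w B = ∑ B with A < B, w' B := by
    refine Finset.sum_congr rfl fun B hB => ?_
    by_contra hB'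
    exact (hmax B hB').not_gt (Finset.card_lt_card (Finset.mem_filter.1 hB).2)
  exact hA (by linarith)

theorem exists_height_eq_total (hc : IsChain (· ≤ ·) {A | w A ≠ 0}) (hw : ∃ A, w A ≠ 0) :
    ∃ A, w A ≠ 0 ∧ ∀ i ∈ A.1, height w i = ∑ B, w B := by
  obtain ⟨A, hA, hmin⟩ := (Finset.univ.filter fun A => w A ≠ 0).exists_min_image
    (fun A => A.1.card) (by
      obtain ⟨A, hA⟩ := hw
      exact ⟨A, by simpa using hA⟩)
  simp only [Finset.mem_filter, Finset.mem_univ, true_and] at hA hmin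
  refine ⟨A, hA, fun i hi => Finset.sum_subset (Finset.subset_univ _) fun B _ hB => ?_⟩
  simp only [Finset.mem_filter, Finset.mem_univ, true_and] at hB
  by_contra hwB
  rcases hc.total hA hwB with h | h
  · exact hB (h hi)
  · exact hB (Finset.eq_of_subset_of_card_le h (hmin B hwB) ▸ hi)

/-- Layer-cake decomposition: give the support s of y its least nonzero value as weight, subtract
that value on s, and recurse on the strictly smaller support. -/
theorem exists_height_eq (y : T → ℝ) (hy : ∀ i, 0 ≤ y i) :
    ∃ w : {S : Finset T // S.Nonempty} → ℝ, (∀ A, 0 ≤ w A) ∧ IsChain (· ≤ ·) {A | w A ≠ 0} ∧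
      (∀ A, w A ≠ 0 → ∀ i ∈ A.1, y i ≠ 0) ∧ height w = y := by
  obtain ⟨s, hs⟩ : ∃ s, Finset.univ.filter (fun i => y i ≠ 0) = s := ⟨_, rfl⟩
  induction s using Finset.strongInduction generalizing y with
  | H s ih =>
    have hmem : ∀ i, i ∈ s ↔ y i ≠ 0 := fun i => by simp [← hs]
    obtain rfl | hne := s.eq_empty_or_nonempty
    · refine ⟨0, fun _ => le_rfl, by simp [IsChain], by simp, funext fun i => ?_⟩
      have := hmem i
      simp only [Finset.notMem_empty, false_iff, not_not] at this
      simp [height, this]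
    · obtain ⟨i₀, hi₀, hmin⟩ := s.exists_min_image y hne
      have hpos : 0 < y i₀ := lt_of_le_of_ne (hy i₀) (Ne.symm ((hmem i₀).1 hi₀))
      let y' : T → ℝ := fun i => if i ∈ s then y i - y i₀ else 0
      have hy's : ∀ i, y' i ≠ 0 → i ∈ s := fun i h => by
        by_contra his
        simp [y', his] at h
      obtain ⟨w, hw0, hwc, hwy, hw⟩ := ih (Finset.univ.filter fun i => y' i ≠ 0)
        ((Finset.ssubset_iff_of_subset fun i hi => hy's i (by simpa using hi)).2
          ⟨i₀, hi₀, by simp [y']⟩) y' (fun i => by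
            simp only [y']
            split_ifs with h
            · linarith [hmin i h]
            · exact le_rfl) rfl
      have hws : ∀ A, w A ≠ 0 → A.1 ⊆ s := fun A hA i hi => hy's i (hwy A hA i hi)
      refine ⟨w + Pi.single ⟨s, hne⟩ (y i₀), fun A => add_nonneg (hw0 A) ?_, ?_, ?_, ?_⟩
      · by_cases hA : A = ⟨s, hne⟩
        · subst hA; simpa using hpos.le
        · simp [hA]
      · refine (hwc.insert (a := ⟨s, hne⟩) fun B hB _ => .inr (hws B hB)).mono fun A hA => ?_
        by_cases hAs : A = ⟨s, hne⟩
        · exact .inl hAs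
        · exact .inr (by simpa [hAs] using hA)
      · intro A hA i hi
        by_cases hAs : A = ⟨s, hne⟩
        · subst hAs
          exact (hmem i).1 hi
        · exact (hmem i).1 (hws A (by simpa [hAs] using hA) hi)
      · funext i
        have h1 := congrFun hw i
        simp only [height] at h1 ⊢
        simp only [Pi.add_apply, Finset.sum_add_distrib, h1, Finset.sum_pi_single',
          Finset.mem_filter, Finset.mem_univ, true_and, y']
        by_cases his : i ∈ s
        · simp [his]
        · have := mt (hmem i).2 his
          simp only [not_not] at this
          simp [his, this]

variable {c d : {S : Finset T // S.Nonempty}}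

theorem height_nonneg (w : NerveBelow c) (i : T) : 0 ≤ height w.1 i :=
  Finset.sum_nonneg fun A _ => w.1.2.1 A

theorem height_le_one (w : NerveBelow c) (i : T) : height w.1 i ≤ 1 :=
  (Finset.sum_le_sum_of_subset_of_nonneg (Finset.subset_univ _) fun A _ _ => w.1.2.1 A).trans
    w.1.2.2.le

theorem height_eq_zero (w : NerveBelow c) {i : T} (hi : i ∉ c.1) : height w.1 i = 0 := by
  refine Finset.sum_eq_zero fun A hA => ?_
  by_contra hwA
  exact hi (w.2.2 A hwA (Finset.mem_filter.1 hA).2)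

theorem exists_height_eq_one (w : NerveBelow c) : ∃ i ∈ c.1, height w.1 i = 1 := by
  obtain ⟨A, hA, h⟩ := exists_height_eq_total (w := w.1) w.2.1 (by
    by_contra hw
    push Not at hw
    have := w.1.2.2
    exact zero_ne_one ((Finset.sum_eq_zero fun A _ => hw A).symm.trans this))
  obtain ⟨i, hi⟩ := A.2
  exact ⟨i, w.2.2 A hA hi, (h i hi).trans w.1.2.2⟩

theorem continuous_height (i : T) : Continuous fun w : NerveBelow c => height w.1 i :=
  continuous_finsetSum _ fun A _ => (continuous_apply A).comp
    (continuous_subtype_val.comp continuous_subtype_val)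

/-- The coordinates of the cone on a nerve in a cube. -/
def coneCoord (t : I) (w : NerveBelow c) (i : T) : I :=
  ⟨1 - t * height w.1 i, by
    have h1 := height_nonneg w i
    have h2 := height_le_one w i
    have h3 := t.2.1
    have h4 := t.2.2
    constructor <;> nlinarith⟩

theorem continuous_coneCoord : Continuous fun q : I × NerveBelow c => coneCoord q.1 q.2 :=
  continuous_pi fun i => Continuous.subtype_mk (continuous_const.sub
    ((continuous_subtype_val.comp continuous_fst).mul
      ((continuous_height i).comp continuous_snd))) _

theorem trunc_coneCoord (t : I) (w : NerveBelow c) : trunc c.1 (coneCoord t w) = coneCoord t w := by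
  funext i
  unfold trunc
  split_ifs with h
  · rfl
  · exact Subtype.ext (by simp [coneCoord, height_eq_zero w h])

theorem coneCoord_zero (w : NerveBelow c) : coneCoord 0 w = 1 :=
  funext fun i => Subtype.ext (by simp [coneCoord])

theorem exists_coneCoord_one (w : NerveBelow c) : ∃ i ∈ c.1, coneCoord 1 w i = 0 := by
  obtain ⟨i, hi, h⟩ := exists_height_eq_one w
  exact ⟨i, hi, Subtype.ext (by simp [coneCoord, h])⟩

theorem eq_one_of_coneCoord_eq_zero {t : I} {w : NerveBelow c} {i : T}
    (h : coneCoord t w i = 0) : t = 1 := by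
  have h' : 1 - (t : ℝ) * height w.1 i = 0 := congrArg Subtype.val h
  have h2 := height_le_one w i
  refine Subtype.ext (le_antisymm t.2.2 ?_)
  have h3 := t.2.1
  simp only [Set.Icc.coe_one]
  nlinarith

/-- The greatest height is 1, so the cone parameter is read off as one minus the least coordinate.
-/
theorem coneCoord_le {t t' : I} {w w' : NerveBelow c} (h : coneCoord t w = coneCoord t' w') :
    t ≤ t' := by
  obtain ⟨i, -, hi⟩ := exists_height_eq_one w
  have h' : 1 - (t : ℝ) * height w.1 i = 1 - t' * height w'.1 i :=
    congrArg Subtype.val (congrFun h i)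
  have h2 := height_le_one w' i
  have h3 := t'.2.1
  rw [hi] at h'
  change (t : ℝ) ≤ t'
  nlinarith

theorem coneCoord_injective {t t' : I} {w w' : NerveBelow c} (h : coneCoord t w = coneCoord t' w') :
    t = t' ∧ (t = 0 ∨ w = w') := by
  obtain rfl : t = t' := le_antisymm (coneCoord_le h) (coneCoord_le h.symm)
  refine ⟨rfl, or_iff_not_imp_left.2 fun ht => ?_⟩
  have ht' : (t : ℝ) ≠ 0 := fun h => ht (Subtype.ext h)
  refine Subtype.ext (Subtype.ext (eq_of_height_eq w.1.2.1 w.2.1 w'.1.2.1 w'.2.1 ?_))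
  funext i
  have h' : 1 - (t : ℝ) * height w.1 i = 1 - t * height w'.1 i :=
    congrArg Subtype.val (congrFun h i)
  exact mul_left_cancel₀ ht' (sub_right_injective h')

instance : Nonempty (NerveBelow c) := by
  refine ⟨⟨⟨Pi.single c 1, single_mem_stdSimplex ℝ c⟩, ?_, ?_⟩⟩
  · refine (Set.subsingleton_singleton (a := c)).isChain.mono fun A hA => ?_
    by_contra hAc
    exact hA (Pi.single_eq_of_ne hAc 1)
  · intro A hA
    by_contra hAc
    exact hA (Pi.single_eq_of_ne (fun h => hAc h.le) 1)

/-- Let t be one minus the least coordinate; t = 0 is the cone point. Otherwise (1 - z)/t has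
maximum 1, so the weights of its layer-cake decomposition sum to 1. -/
theorem exists_coneCoord_eq {z : T → I} (hz : trunc c.1 z = z) :
    ∃ (t : I) (w : NerveBelow c), coneCoord t w = z := by
  obtain ⟨i₀, hi₀, hmin⟩ := c.1.exists_min_image (fun i => (z i : ℝ)) c.2
  have hmin' : ∀ i, (z i₀ : ℝ) ≤ z i := fun i => by
    by_cases hi : i ∈ c.1
    · exact hmin i hi
    · rw [← congrFun hz i, trunc, if_neg hi]
      exact (z i₀).2.2
  let t : I := unitInterval.symm (z i₀)
  have ht : (t : ℝ) = 1 - z i₀ := rfl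
  by_cases ht0 : (t : ℝ) = 0
  · refine ⟨0, Classical.arbitrary _, (coneCoord_zero _).trans (funext fun i => Subtype.ext ?_)⟩
    have := hmin' i
    have := (z i).2.2
    simp only [Pi.one_apply, Set.Icc.coe_one]
    linarith
  have htpos : 0 < (t : ℝ) := lt_of_le_of_ne t.2.1 (Ne.symm ht0)
  obtain ⟨w, h0, hch, hsupp, hw⟩ := exists_height_eq (fun i => (1 - z i) / (t : ℝ))
    fun i => div_nonneg (sub_nonneg.2 (z i).2.2) t.2.1
  have hne : ∃ A, w A ≠ 0 := by
    by_contra hne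
    push Not at hne
    have h1 := congrFun hw i₀
    rw [height, Finset.sum_eq_zero fun A _ => hne A, ← ht, div_self ht0] at h1
    exact zero_ne_one h1
  have hsum : ∑ A, w A = 1 := by
    obtain ⟨A, hA, htot⟩ := exists_height_eq_total hch hne
    obtain ⟨i, hi⟩ := A.2
    have h1 := htot i hi
    have h2 : height w i₀ ≤ ∑ A, w A :=
      Finset.sum_le_sum_of_subset_of_nonneg (Finset.subset_univ _) fun A _ _ => h0 A
    rw [hw] at h1 h2
    simp only [← ht, div_self ht0] at h2
    refine le_antisymm (h1 ▸ (div_le_one htpos).2 ?_) h2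
    linarith [hmin' i]
  refine ⟨t, ⟨⟨w, h0, hsum⟩, hch, fun A hA i hi => ?_⟩, funext fun i => Subtype.ext ?_⟩
  · by_contra hic
    refine hsupp A hA i hi ?_
    rw [← congrFun hz i, trunc, if_neg hic]
    simp
  · change 1 - (t : ℝ) * height w i = z i
    rw [hw]
    field_simp
    ring

instance : CompactSpace (NerveBelow c) := by
  have hcl : IsClosed {w : stdSimplex ℝ {S : Finset T // S.Nonempty} |
      IsChain (· ≤ ·) {p | w p ≠ 0} ∧ ∀ p, w p ≠ 0 → p ≤ c} := by
    have hco : ∀ p, Continuous fun w : stdSimplex ℝ {S : Finset T // S.Nonempty} => w p :=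
      fun p => (continuous_apply p).comp continuous_subtype_val
    have heq : {w : stdSimplex ℝ {S : Finset T // S.Nonempty} |
        IsChain (· ≤ ·) {p | w p ≠ 0} ∧ ∀ p, w p ≠ 0 → p ≤ c} =
        (⋂ p, ⋂ q, ⋂ _ : ¬ (p ≤ q ∨ q ≤ p), {w | w p * w q = 0}) ∩
          ⋂ p, ⋂ _ : ¬ p ≤ c, {w | w p = 0} := by
      ext w
      simp only [Set.mem_ofPred_eq, Set.mem_inter_iff, Set.mem_iInter, mul_eq_zero]
      refine and_congr ⟨fun h p q hpq => ?_, fun h p hp q hq _ => ?_⟩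
        ⟨fun h p hp => ?_, fun h p hp => ?_⟩
      · by_contra hw
        push Not at hw
        exact hpq (h.total hw.1 hw.2)
      · by_contra hpq
        exact (h p q hpq).elim hp hq
      · by_contra hw
        exact hp (h p hw)
      · by_contra hpc
        exact hp (h p hpc)
    rw [heq]
    refine IsClosed.inter ?_ ?_
    · exact isClosed_iInter fun p => isClosed_iInter fun q => isClosed_iInter fun _ =>
        isClosed_eq ((hco p).mul (hco q)) continuous_const
    · exact isClosed_iInter fun p => isClosed_iInter fun _ => isClosed_eq (hco p) continuous_const
  exact isCompact_iff_compactSpace.1 hcl.isCompact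

/-- Maps out of the cone on a nerve extend to maps out of the cube. -/
theorem exists_cube_map {Y : Type} [TopologicalSpace Y] [CompactSpace Y] [T2Space Y] {A : Type u}
    [TopologicalSpace A] (g : C(Y × (I × NerveBelow c), A))
    (h0 : ∀ y w w', g (y, 0, w) = g (y, 0, w')) :
    ∃ φ : C(Y × (T → I), A), (∀ y z, φ (y, trunc c.1 z) = φ (y, z)) ∧
      ∀ y t w, φ (y, coneCoord t w) = g (y, t, w) := by
  let q : C(Y × (I × NerveBelow c), Y × {z : T → I // trunc c.1 z = z}) :=
    ⟨fun x => (x.1, ⟨coneCoord x.2.1 x.2.2, trunc_coneCoord _ _⟩),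
      continuous_fst.prodMk ((continuous_coneCoord.comp continuous_snd).subtype_mk _)⟩
  have hsurj : Function.Surjective q := by
    rintro ⟨y, z, hz⟩
    obtain ⟨t, w, rfl⟩ := exists_coneCoord_eq hz
    exact ⟨(y, t, w), rfl⟩
  -- A continuous surjection from a compact space to a Hausdorff space is a quotient map, so g
  -- descends once it is constant on the cone point.
  have hq : Topology.IsQuotientMap q := q.continuous.isClosedMap.isQuotientMap q.continuous hsurj
  have hfac : Function.FactorsThrough g q := by
    rintro ⟨y, t, w⟩ ⟨y', t', w'⟩ h
    obtain rfl : y = y' := congrArg Prod.fst h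
    obtain ⟨rfl, rfl | rfl⟩ := coneCoord_injective (congrArg (fun x => x.2.1) h)
    · exact h0 _ _ _
    · rfl
  have hr : Continuous fun x : Y × (T → I) =>
      ((x.1, ⟨trunc c.1 x.2, trunc_of_le le_rfl _⟩) : Y × {z : T → I // trunc c.1 z = z}) :=
    continuous_fst.prodMk (((continuous_trunc _).comp continuous_snd).subtype_mk _)
  refine ⟨(hq.lift g hfac).comp ⟨_, hr⟩, fun y z => ?_, fun y t w => ?_⟩
  · refine congrArg (hq.lift g hfac) (Prod.ext rfl (Subtype.ext ?_))
    exact trunc_of_le le_rfl z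
  · have h : ((y, ⟨trunc c.1 (coneCoord t w), trunc_of_le le_rfl _⟩) :
        Y × {z : T → I // trunc c.1 z = z}) = q (y, t, w) :=
      Prod.ext rfl (Subtype.ext (trunc_coneCoord t w))
    exact (congrArg (hq.lift g hfac) h).trans
      (DFunLike.congr_fun (hq.lift_comp g hfac) (y, t, w))

end Nerve

/-! ### Fibrant cubes -/

section Cubes

variable {T : Type} {F : Finset T ⥤ TopCat.{u}}

/-- The image in `F S` of a point of `F ∅`. -/
def push (F : Finset T ⥤ TopCat.{u}) (S : Finset T) : C(F.obj ∅, F.obj S) :=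
  (F.map (homOfLE (Finset.empty_subset S))).hom

theorem map_map {S S' S'' : Finset T} (h : S ≤ S') (h' : S' ≤ S'') (x : F.obj S) :
    F.map (homOfLE h') (F.map (homOfLE h) x) = F.map (homOfLE (h.trans h')) x := by
  rw [← ConcreteCategory.comp_apply, ← F.map_comp, homOfLE_comp]

theorem map_push {S S' : Finset T} (h : S ≤ S') (x : F.obj ∅) :
    F.map (homOfLE h) (push F S x) = push F S' x :=
  map_map _ h x

theorem map_refl {S : Finset T} (x : F.obj S) : F.map (homOfLE (le_refl S)) x = x :=
  ConcreteCategory.congr_hom (F.map_id S) x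

theorem push_empty (x : F.obj ∅) : push F ∅ x = x :=
  map_refl x

/-- For nonempty S both ends of time are prescribed and the initial faces z_i = 0 with i in S serve
as the one-sided directions. For S = ∅ the final end is free, and time itself is the one-sided
direction. -/
theorem exists_box (N T : Type) (S : Finset T) :
    ∃ (e : ((N → I) × I) × (T → I) ≃ₜ ((N ⊕ Unit) ⊕ T → I)) (D E : Set ((N ⊕ Unit) ⊕ T)),
      Disjoint D E ∧ E.Nonempty ∧ ∀ q, e q ∈ box D E ↔ q.1.2 = 0 ∨ q.1.1 ∈ Cube.boundary N ∨
        S.Nonempty ∧ (q.1.2 = 1 ∨ ∃ i ∈ S, q.2 i = 0) := by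
  refine ⟨((cubeProdI N).prodCongr (.refl _)).trans (cubeProd _ _), ?_⟩
  obtain rfl | hS := S.eq_empty_or_nonempty
  · refine ⟨Set.range (.inl ∘ .inl), {.inl (.inr ())}, ?_, Set.singleton_nonempty _, fun q => ?_⟩
    · rw [Set.disjoint_singleton_right]
      rintro ⟨i, hi⟩
      exact Sum.inl_ne_inr (Sum.inl_injective hi)
    · simp only [Finset.not_nonempty_empty, false_and, or_false]
      constructor
      · rintro (⟨_, ⟨i, rfl⟩, h⟩ | ⟨_, rfl, h⟩)
        · exact .inr ⟨i, h⟩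
        · exact .inl h
      · rintro (h | ⟨i, h⟩)
        · exact .inr ⟨_, rfl, h⟩
        · exact .inl ⟨_, ⟨i, rfl⟩, h⟩
  · refine ⟨Set.range .inl, .inr '' S, ?_, hS.to_set.image _, fun q => ?_⟩
    · rw [Set.disjoint_left]
      rintro _ ⟨i, rfl⟩ ⟨k, -, hk⟩
      exact Sum.inr_ne_inl hk
    · simp only [hS, true_and]
      constructor
      · rintro (⟨_, ⟨i | i, rfl⟩, h⟩ | ⟨_, ⟨i, hi, rfl⟩, h⟩)
        · exact .inr (.inl ⟨i, h⟩)
        · rcases h with h | h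
          · exact .inl h
          · exact .inr (.inr (.inl h))
        · exact .inr (.inr (.inr ⟨i, hi, h⟩))
      · rintro (h | ⟨i, h⟩ | h | ⟨i, hi, h⟩)
        · exact .inl ⟨_, ⟨.inr (), rfl⟩, .inl h⟩
        · exact .inl ⟨_, ⟨.inl i, rfl⟩, h⟩
        · exact .inl ⟨_, ⟨.inr (), rfl⟩, .inr h⟩
        · exact .inr ⟨_, ⟨i, hi, rfl⟩, h⟩

variable [DecidableEq T]

/-- The conditions on the component at `S` of a deformation of a total family `φ`, relative to the
boundary, to the family given by points of the strict fiber. -/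
structure IsDeformation {N : Type} (b : F.obj ∅) (φ : ∀ S, C((N → I) × (T → I), F.obj S))
    (a : (N → I) → F.obj ∅) (Ψ : ∀ S, C(((N → I) × I) × (T → I), F.obj S)) (S : Finset T) :
    Prop where
  zero : ∀ x z, Ψ S ((x, 0), z) = φ S (x, z)
  boundary : ∀ x ∈ Cube.boundary N, ∀ t z, Ψ S ((x, t), z) = push F S (a x)
  one : S.Nonempty → ∀ x z, Ψ S ((x, 1), z) = push F S b
  face : ∀ q z i, i ∈ S → z i = 0 → Ψ S (q, z) = push F S b
  map : ∀ S' (h : S ≤ S') q z, F.map (homOfLE h) (Ψ S (q, z)) = Ψ S' (q, trunc S z)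

theorem IsDeformation.congr {N : Type} {b : F.obj ∅} {φ : ∀ S, C((N → I) × (T → I), F.obj S)}
    {a : (N → I) → F.obj ∅}
    {Ψ Ψ' : ∀ S, C(((N → I) × I) × (T → I), F.obj S)} {S : Finset T}
    (h : IsDeformation b φ a Ψ S) (h' : ∀ S', S ≤ S' → Ψ' S' = Ψ S') :
    IsDeformation b φ a Ψ' S := by
  have hS := h' S le_rfl
  refine ⟨fun x z => ?_, fun x hx t z => ?_, fun hne x z => ?_, fun q z i hi hz => ?_,
    fun S' hSS' q z => ?_⟩
  · rw [hS, h.zero]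
  · rw [hS, h.boundary x hx]
  · rw [hS, h.one hne]
  · rw [hS, h.face q z i hi hz]
  · rw [hS, h' S' hSS', h.map S' hSS']

/-- A natural family of maps from cubes to the vertices of `F`, parametrized by `Y`, which maps the
initial faces to the base point. -/
structure IsTotalFamily {Y : Type} [TopologicalSpace Y] (F : Finset T ⥤ TopCat.{u}) (b : F.obj ∅)
    (φ : ∀ S, C(Y × (T → I), F.obj S)) : Prop where
  map : ∀ {S S'} (h : S ≤ S') y z, F.map (homOfLE h) (φ S (y, z)) = φ S' (y, trunc S z)
  face : ∀ {S y z i}, i ∈ S → z i = 0 → φ S (y, z) = push F S b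

theorem IsTotalFamily.trunc {Y : Type} [TopologicalSpace Y] {b : F.obj ∅}
    {φ : ∀ S, C(Y × (T → I), F.obj S)} (h : IsTotalFamily F b φ) (S : Finset T) (y : Y) (z : T → I) :
    φ S (y, TotLayer.trunc S z) = φ S (y, z) :=
  (h.map le_rfl y z).symm.trans (map_refl _)

end Cubes

section TotalFiber

variable {T : Type} {F : Finset T ⥤ TopCat.{u}}

theorem Tfiber.ext [Fintype T] {b : F.obj ∅} {x y : Tfiber F b} (h : x.1.1 = y.1.1)
    (h' : ∀ t S w, (x.1.2 t).1 S w = (y.1.2 t).1 S w) : x = y :=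
  Subtype.ext (Prod.ext h (ContinuousMap.ext fun t => Subtype.ext (funext fun S =>
    ContinuousMap.ext fun w => h' t S w)))

end TotalFiber

/-! ### Strict and homotopy total fibers of fibrant cubes -/

section FibrantCube

variable {T : Type} [Fintype T] [DecidableEq T] {F : Finset T ⥤ TopCat.{u}}

/-- A cube is fibrant if the maps from its vertices to the limits of the larger vertices have the
right lifting property with respect to boxes. -/
def IsFibrantCube (F : Finset T ⥤ TopCat.{u}) : Prop :=
  ∀ (S : Finset T) {N K : Type} [Finite N] [TopologicalSpace K] (e : K ≃ₜ (N → I)) {D E : Set N},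
    Disjoint D E → E.Nonempty → ∀ l₀ : K → F.obj S, ContinuousOn l₀ (e ⁻¹' box D E) →
    ∀ θ : ∀ i, C(K, F.obj (insert i S)),
    (∀ i k U (hi : insert i S ≤ U) (hk : insert k S ≤ U), i ∉ S → k ∉ S → ∀ x,
      F.map (homOfLE hi) (θ i x) = F.map (homOfLE hk) (θ k x)) →
    (∀ x, e x ∈ box D E → ∀ i, i ∉ S →
      F.map (homOfLE (Finset.subset_insert i S)) (l₀ x) = θ i x) →
    ∃ l : C(K, F.obj S), (∀ x, e x ∈ box D E → l x = l₀ x) ∧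
      ∀ i, i ∉ S → ∀ x, F.map (homOfLE (Finset.subset_insert i S)) (l x) = θ i x

theorem cubeMap_eq_iff {x y : F.obj ∅} :
    cubeMap F x = cubeMap F y ↔ ∀ S : Finset T, S.Nonempty → push F S x = push F S y := by
  constructor
  · intro h S hS
    exact DFunLike.congr_fun (congrFun (congrArg Subtype.val h) ⟨S, hS⟩)
      (Classical.arbitrary (NerveBelow _))
  · intro h
    exact Subtype.ext (funext fun S => ContinuousMap.ext fun _ => h S.1 S.2)

variable {Y : Type} [TopologicalSpace Y] {b : F.obj ∅}

namespace IsTotalFamily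

variable {φ : ∀ S, C(Y × (T → I), F.obj S)}

/-- The family of points of the homotopy limit given by a total family. -/
def toHolim (h : IsTotalFamily F b φ) : C(Y × I, Holim (subcube F)) where
  toFun q := ⟨fun S => (φ S.1).comp ⟨fun w => (q.1, coneCoord q.2 w),
      continuous_const.prodMk (continuous_coneCoord.comp (.prodMk_right q.2))⟩, by
    intro S S' hS w
    refine Eq.trans ?_ (h.map hS q.1 (coneCoord q.2 w)).symm
    exact congrArg (fun z => φ S'.1 (q.1, z)) (trunc_coneCoord q.2 w).symm⟩
  continuous_toFun := by
    refine Continuous.subtype_mk (continuous_pi fun S => ?_) _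
    refine ContinuousMap.continuous_of_continuous_uncurry _ ?_
    exact (φ S.1).continuous.comp ((continuous_fst.comp continuous_fst).prodMk
      (continuous_coneCoord.comp ((continuous_snd.comp continuous_fst).prodMk continuous_snd)))

/-- The family of points of the total homotopy fiber given by a total family. -/
def toTfiber (h : IsTotalFamily F b φ) : C(Y, Tfiber F b) where
  toFun y := ⟨(φ ∅ (y, 1), h.toHolim.curry y), by
    refine Subtype.ext (funext fun S => ContinuousMap.ext fun w => ?_)
    refine Eq.trans (congrArg (fun z => φ S.1 (y, z)) (coneCoord_zero w)) ?_
    refine Eq.trans (congrArg (fun z => φ S.1 (y, z)) (trunc_empty 1).symm) ?_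
    exact (h.map (Finset.empty_subset S.1) y 1).symm, by
    refine Subtype.ext (funext fun S => ContinuousMap.ext fun w => ?_)
    obtain ⟨i, hi, hw⟩ := exists_coneCoord_one w
    exact h.face hi hw⟩
  continuous_toFun := Continuous.subtype_mk (Continuous.prodMk
    ((φ ∅).continuous.comp (.prodMk_left 1)) h.toHolim.curry.continuous) _

end IsTotalFamily

/-- In cubical coordinates the cone point is the corner 1 and the base of the cone is the union of
the faces z_i = 0. A path in the homotopy limit thus becomes a family of maps on cubes, and
naturality along nerves becomes compatibility with `trunc`. -/
theorem exists_totalFamily [CompactSpace Y] [T2Space Y] (g : C(Y, Tfiber F b)) :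
    ∃ φ : ∀ S, C(Y × (T → I), F.obj S), IsTotalFamily F b φ ∧
      (∀ y z, φ ∅ (y, z) = (g y).1.1) ∧
      ∀ S y t w, φ S.1 (y, coneCoord t w) = ((g y).1.2 t).1 S w := by
  have h0 : ∀ y S w, ((g y).1.2 0).1 S w = push F S.1 (g y).1.1 := fun y S w => by
    rw [(g y).2.1]; rfl
  have h1 : ∀ y S w, ((g y).1.2 1).1 S w = push F S.1 b := fun y S w => by
    rw [(g y).2.2]; rfl
  have hg : ∀ S : {S : Finset T // S.Nonempty}, Continuous fun q : Y × (I × NerveBelow S) =>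
      ((g q.1).1.2 q.2.1).1 S q.2.2 := by
    intro S
    have hG : Continuous fun q : Y × (I × NerveBelow S) => (g q.1).1.2 q.2.1 :=
      Continuous.eval (continuous_snd.comp
        (continuous_subtype_val.comp (g.continuous.comp continuous_fst)))
        (continuous_fst.comp continuous_snd)
    exact Continuous.eval ((continuous_apply S).comp (continuous_subtype_val.comp hG))
      (continuous_snd.comp continuous_snd)
  choose φ hφt hφ using fun S : {S : Finset T // S.Nonempty} =>
    exists_cube_map ⟨_, hg S⟩ fun y w w' => (h0 y S w).trans (h0 y S w').symm
  -- The index ∅ does not occur in the homotopy limit; its component is constant in z at the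
  -- underlying point of `F.obj ∅`.
  let Φ : ∀ S, C(Y × (T → I), F.obj S) := fun S =>
    if hS : S.Nonempty then φ ⟨S, hS⟩ else
      ⟨fun q => push F S (g q.1).1.1, (push F S).continuous.comp (continuous_fst.comp
        (continuous_subtype_val.comp (g.continuous.comp continuous_fst)))⟩
  have hΦ : ∀ S : {S : Finset T // S.Nonempty}, Φ S.1 = φ S := fun S => dif_pos S.2
  have hΦ0 : ∀ y z, Φ ∅ (y, z) = (g y).1.1 := fun y z => by
    have : Φ ∅ = ⟨fun q => push F ∅ (g q.1).1.1, _⟩ := dif_neg Finset.not_nonempty_empty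
    rw [this]
    exact push_empty _
  have hcone : ∀ S y t w, Φ S.1 (y, coneCoord t w) = ((g y).1.2 t).1 S w := fun S y t w => by
    rw [hΦ]
    exact hφ S y t w
  have hone : ∀ S y, Φ S (y, 1) = push F S (g y).1.1 := fun S y => by
    obtain rfl | hS := S.eq_empty_or_nonempty
    · rw [hΦ0, push_empty]
    · have w : NerveBelow (⟨S, hS⟩ : {S : Finset T // S.Nonempty}) := Classical.arbitrary _
      rw [← coneCoord_zero w, hcone ⟨S, hS⟩ y 0 w, h0]
  have htr : ∀ S : {S : Finset T // S.Nonempty}, ∀ y z, Φ S.1 (y, trunc S.1 z) = Φ S.1 (y, z) :=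
    fun S y z => by rw [hΦ]; exact hφt S y z
  refine ⟨Φ, ⟨fun {S S'} h y z => ?_, fun {S y z i} hi hz => ?_⟩, hΦ0, hcone⟩
  · obtain rfl | hS := S.eq_empty_or_nonempty
    · rw [trunc_empty, hone, hΦ0]
      rfl
    · have hS' : S'.Nonempty := hS.mono h
      obtain ⟨t, w, hw⟩ := exists_coneCoord_eq
        (c := (⟨S, hS⟩ : {S : Finset T // S.Nonempty})) (trunc_of_le (le_refl S) z)
      have e1 : Φ S (y, z) = ((g y).1.2 t).1 ⟨S, hS⟩ w := by
        rw [← htr ⟨S, hS⟩, ← hw]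
        exact hcone ⟨S, hS⟩ y t w
      have e2 : Φ S' (y, trunc S z) = ((g y).1.2 t).1 ⟨S', hS'⟩ (NerveBelow.incl h w) := by
        rw [← hw]
        exact hcone ⟨S', hS'⟩ y t (NerveBelow.incl h w)
      rw [e1, e2]
      exact (((g y).1.2 t).2 ⟨S, hS⟩ ⟨S', hS'⟩ h w).symm
  · have hS : S.Nonempty := ⟨i, hi⟩
    obtain ⟨t, w, hw⟩ := exists_coneCoord_eq
      (c := (⟨S, hS⟩ : {S : Finset T // S.Nonempty})) (trunc_of_le (le_refl S) z)
    obtain rfl : t = 1 := eq_one_of_coneCoord_eq_zero (w := w) (i := i) (by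
      rw [hw, trunc_apply_of_mem hi, hz])
    rw [← htr ⟨S, hS⟩, ← hw]
    exact (hcone ⟨S, hS⟩ y 1 w).trans (h1 y ⟨S, hS⟩ w)

variable {N : Type} [Finite N] {φ : ∀ S, C((N → I) × (T → I), F.obj S)} {a : (N → I) → F.obj ∅}

/-- Once the components at larger sets are known, naturality prescribes the images of the component
at S in all `F.obj (insert i S)`. The remaining conditions prescribe it on a box, so fibrancy at S
provides it. -/
theorem IsFibrantCube.exists_deformation_step (hF : IsFibrantCube F) (hφ : IsTotalFamily F b φ)
    (ha : ContinuousOn a (Cube.boundary N))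
    (haφ : ∀ x ∈ Cube.boundary N, ∀ S z, φ S (x, z) = push F S (a x))
    (hab : ∀ x ∈ Cube.boundary N, ∀ S : Finset T, S.Nonempty → push F S (a x) = push F S b)
    {Ψ : ∀ S, C(((N → I) × I) × (T → I), F.obj S)} {S : Finset T}
    (hΨ : ∀ i, i ∉ S → ∀ S', insert i S ≤ S' → IsDeformation b φ a Ψ S') :
    ∃ ψ : C(((N → I) × I) × (T → I), F.obj S), IsDeformation b φ a (Function.update Ψ S ψ) S := by
  obtain ⟨e, D, E, hDE, hE, hbox⟩ := exists_box N T S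
  have hne : Nonempty (F.obj S) := ⟨push F S b⟩
  obtain ⟨d, hd, hd'⟩ := exists_continuousOn_glue
    (Y := ((N → I) × I) × (T → I)) (Z := F.obj S) (T := Fin 3)
    ![{q | q.1.2 = 0}, {q | q.1.1 ∈ Cube.boundary N},
      {q | S.Nonempty ∧ (q.1.2 = 1 ∨ ∃ i ∈ S, q.2 i = 0)}]
    ![fun q => φ S (q.1.1, q.2), fun q => push F S (a q.1.1), fun _ => push F S b]
    (by
      intro k
      fin_cases k
      · exact isClosed_eq (continuous_snd.comp continuous_fst) continuous_const
      · exact Cube.isClosed_boundary.preimage (continuous_fst.comp continuous_fst)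
      · by_cases hS : S.Nonempty
        · have : {q : ((N → I) × I) × (T → I) | S.Nonempty ∧ (q.1.2 = 1 ∨ ∃ i ∈ S, q.2 i = 0)} =
              {q | q.1.2 = 1} ∪ ⋃ i ∈ S, {q | q.2 i = 0} := by
            ext q
            simp [hS]
          refine this ▸ IsClosed.union
            (isClosed_eq (continuous_snd.comp continuous_fst) continuous_const) ?_
          exact isClosed_biUnion_finset fun i _ =>
            isClosed_eq ((continuous_apply i).comp continuous_snd) continuous_const
        · have : {q : ((N → I) × I) × (T → I) | S.Nonempty ∧ (q.1.2 = 1 ∨ ∃ i ∈ S, q.2 i = 0)} =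
              ∅ := by
            ext q
            simp [hS]
          exact this ▸ isClosed_empty)
    (by
      intro k
      fin_cases k
      · exact ((φ S).continuous.comp ((continuous_fst.comp continuous_fst).prodMk
          continuous_snd)).continuousOn
      · exact (push F S).continuous.comp_continuousOn
          (ha.comp (continuous_fst.comp continuous_fst).continuousOn fun q hq => hq)
      · exact continuousOn_const)
    (by
      have h02 : ∀ q : ((N → I) × I) × (T → I), q.1.2 = 0 →
          (S.Nonempty ∧ (q.1.2 = 1 ∨ ∃ i ∈ S, q.2 i = 0)) →
          φ S (q.1.1, q.2) = push F S b := by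
        rintro ⟨⟨x, t⟩, z⟩ h0 ⟨-, h1 | ⟨i, hi, hz⟩⟩
        · exact (zero_ne_one (h0.symm.trans h1)).elim
        · exact hφ.face hi hz
      rintro k l q hk hl
      fin_cases k <;> fin_cases l
      · rfl
      · exact haφ _ hl S _
      · exact h02 q hk hl
      · exact (haφ _ hk S _).symm
      · rfl
      · exact hab _ hk S hl.1
      · exact (h02 q hl hk).symm
      · exact (hab _ hl S hk.1).symm
      · rfl)
  have hd0 := hd' 0
  have hd1 := hd' 1
  have hd2 := hd' 2
  simp only [Matrix.cons_val, Set.mem_ofPred_eq] at hd0 hd1 hd2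
  obtain ⟨l, hl, hlF⟩ := hF S e hDE hE d
    (hd.mono fun q hq => by
      rcases (hbox q).1 hq with hq | hq | hq
      · exact Set.mem_iUnion.2 ⟨0, hq⟩
      · exact Set.mem_iUnion.2 ⟨1, hq⟩
      · exact Set.mem_iUnion.2 ⟨2, hq⟩)
    (fun i => (Ψ (insert i S)).comp ⟨fun q => (q.1, trunc S q.2),
      continuous_fst.prodMk ((continuous_trunc S).comp continuous_snd)⟩)
    (fun i k U hi hk hiS hkS q => by
      have key : ∀ i (hi : insert i S ≤ U), i ∉ S →
          F.map (homOfLE hi) (Ψ (insert i S) (q.1, trunc S q.2)) = Ψ U (q.1, trunc S q.2) :=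
        fun i hi hiS => by
          rw [(hΨ i hiS _ le_rfl).map U hi, trunc_of_le (Finset.subset_insert i S)]
      exact (key i hi hiS).trans (key k hk hkS).symm)
    (by
      rintro ⟨⟨x, t⟩, z⟩ hq i hi
      have hΨi := hΨ i hi _ le_rfl
      change _ = Ψ (insert i S) ((x, t), trunc S z)
      rcases (hbox _).1 hq with hq | hq | hq
      · rw [hd0 _ hq]
        obtain rfl : t = 0 := hq
        rw [hΨi.zero]
        exact hφ.map _ x z
      · rw [hd1 _ hq, hΨi.boundary x hq]
        exact map_push _ _
      · rw [hd2 _ hq, map_push]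
        obtain ⟨-, h1 | ⟨k, hk, hz⟩⟩ := hq
        · obtain rfl : t = 1 := h1
          exact (hΨi.one (Finset.insert_nonempty i S) x _).symm
        · exact (hΨi.face _ _ k (Finset.mem_insert_of_mem hk)
            ((trunc_apply_of_mem hk z).trans hz)).symm)
  have hl0 : ∀ x z, l ((x, 0), trunc S z) = φ S (x, z) := fun x z => by
    rw [hl _ ((hbox _).2 (.inl rfl)), hd0 _ rfl, hφ.trunc]
  have hl1 : ∀ x ∈ Cube.boundary N, ∀ t z, l ((x, t), z) = push F S (a x) := fun x hx t z => by
    rw [hl _ ((hbox _).2 (.inr (.inl hx))), hd1 _ hx]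
  have hl2 : ∀ q : ((N → I) × I) × (T → I), S.Nonempty → (q.1.2 = 1 ∨ ∃ i ∈ S, q.2 i = 0) →
      l q = push F S b := fun q hS hq => by
    rw [hl _ ((hbox _).2 (.inr (.inr ⟨hS, hq⟩))), hd2 _ ⟨hS, hq⟩]
  -- Precomposing with `trunc S` removes the dependence on coordinates outside S and preserves the
  -- box conditions, which involve only coordinates in S.
  refine ⟨l.comp ⟨fun q => (q.1, trunc S q.2),
    continuous_fst.prodMk ((continuous_trunc S).comp continuous_snd)⟩, ?_⟩
  constructor
  · intro x z
    rw [Function.update_self]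
    exact hl0 x z
  · intro x hx t z
    rw [Function.update_self]
    exact hl1 x hx t _
  · intro hS x z
    rw [Function.update_self]
    exact hl2 ((x, 1), trunc S z) hS (.inl rfl)
  · intro q z i hi hz
    rw [Function.update_self]
    exact hl2 (q, trunc S z) ⟨i, hi⟩ (.inr ⟨i, hi, (trunc_apply_of_mem hi z).trans hz⟩)
  · intro S' h q z
    rw [Function.update_self]
    obtain rfl | hne := eq_or_ne S S'
    · rw [Function.update_self, map_refl]
      exact congrArg (fun z => l (q, z)) (trunc_of_le le_rfl z).symm
    · rw [Function.update_of_ne hne.symm]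
      obtain ⟨i, hi', hi⟩ := Finset.exists_of_ssubset (lt_of_le_of_ne h hne)
      have hins : insert i S ≤ S' := Finset.insert_subset hi' h
      rw [← map_map (Finset.subset_insert i S) hins]
      refine (congrArg _ (hlF i hi (q, trunc S z))).trans ?_
      refine ((hΨ i hi _ le_rfl).map S' hins q _).trans ?_
      rw [trunc_of_le le_rfl, trunc_of_le (Finset.subset_insert i S)]

theorem IsFibrantCube.exists_deformation (hF : IsFibrantCube F) (hφ : IsTotalFamily F b φ)
    (ha : ContinuousOn a (Cube.boundary N))
    (haφ : ∀ x ∈ Cube.boundary N, ∀ S z, φ S (x, z) = push F S (a x))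
    (hab : ∀ x ∈ Cube.boundary N, ∀ S : Finset T, S.Nonempty → push F S (a x) = push F S b) :
    ∃ Ψ : ∀ S, C(((N → I) × I) × (T → I), F.obj S), ∀ S, IsDeformation b φ a Ψ S := by
  -- Descending induction on the cardinality of S: at stage k the sets of the top k cardinalities
  -- are settled, and the other components are arbitrary.
  have key : ∀ k, ∃ Ψ : ∀ S, C(((N → I) × I) × (T → I), F.obj S),
      ∀ S : Finset T, Fintype.card T < S.card + k → IsDeformation b φ a Ψ S := by
    intro k
    induction k with
    | zero => exact ⟨fun S => .const _ (push F S b), fun S hS =>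
        absurd (Finset.card_le_univ S) (by omega)⟩
    | succ k ih =>
      obtain ⟨Ψ, hΨ⟩ := ih
      have hstep : ∀ S : Finset T, ∃ ψ : C(((N → I) × I) × (T → I), F.obj S),
          Fintype.card T < S.card + (k + 1) →
            IsDeformation b φ a (Function.update Ψ S ψ) S := fun S => by
        by_cases hS : Fintype.card T < S.card + (k + 1)
        · obtain ⟨ψ, hψ⟩ := hF.exists_deformation_step hφ ha haφ hab (Ψ := Ψ) (S := S)
            fun i hi S' hS' => hΨ S' (by
              have := Finset.card_le_card hS'
              rw [Finset.card_insert_of_notMem hi] at this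
              omega)
          exact ⟨ψ, fun _ => hψ⟩
        · exact ⟨Ψ S, fun h => absurd h hS⟩
      choose ψ hψ using hstep
      let Ψ' : ∀ S, C(((N → I) × I) × (T → I), F.obj S) := fun S =>
        if Fintype.card T < S.card + k then Ψ S else ψ S
      refine ⟨Ψ', fun S hS => ?_⟩
      by_cases hS' : Fintype.card T < S.card + k
      · exact (hΨ S hS').congr fun S₁ h₁ => if_pos (by
          have := Finset.card_le_card h₁
          omega)
      · refine (hψ S hS).congr fun S₁ h₁ => ?_
        obtain rfl | hne := eq_or_ne S S₁
        · rw [Function.update_self]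
          exact if_neg hS'
        · rw [Function.update_of_ne hne.symm]
          have := Finset.card_lt_card (lt_of_le_of_ne h₁ hne)
          exact if_pos (by omega)
  obtain ⟨Ψ, hΨ⟩ := key (Fintype.card T + 1)
  exact ⟨Ψ, fun S => hΨ S (by omega)⟩

/-- For a fibrant cube the strict total fiber is equivalent to the total homotopy fiber. -/
theorem IsFibrantCube.isCompressing_fiberInclusion (hF : IsFibrantCube F) (b : F.obj ∅) :
    IsCompressing (fiberInclusion (cubeMap F) (cubeMap F b)) := by
  refine ⟨fun _ => ⟨⟨b, rfl⟩⟩, fun N _ g a ha hag => ?_⟩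
  obtain ⟨φ, hφ, hφ0, hφc⟩ := exists_totalFamily g
  have hab : ∀ x, ∀ S : Finset T, S.Nonempty → push F S (a x).1 = push F S b :=
    fun x => cubeMap_eq_iff.1 (a x).2
  have haφ : ∀ x ∈ Cube.boundary N, ∀ S z, φ S (x, z) = push F S (a x).1 := fun x hx S z => by
    obtain rfl | hS := S.eq_empty_or_nonempty
    · rw [hφ0, push_empty, ← hag x hx]
      rfl
    · obtain ⟨t, w, hw⟩ := exists_coneCoord_eq
        (c := (⟨S, hS⟩ : {S : Finset T // S.Nonempty})) (trunc_of_le (le_refl S) z)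
      rw [← hφ.trunc, ← hw]
      refine (hφc ⟨S, hS⟩ x t w).trans ?_
      rw [← hag x hx, hab x S hS]
      rfl
  obtain ⟨Ψ, hΨ⟩ := hF.exists_deformation (a := fun x => (a x).1) hφ
    (continuous_subtype_val.comp_continuousOn ha) haφ fun x _ => hab x
  have hfam : IsTotalFamily F b Ψ :=
    ⟨fun {S S'} h q z => (hΨ S).map S' h q z, fun {S q z i} hi hz => (hΨ S).face q z i hi hz⟩
  -- At time 1 all components at nonempty S are constant at the base point, so the component at ∅,
  -- left free at that time, lies in the strict fiber.
  refine ⟨⟨fun x => ⟨Ψ ∅ ((x, 1), 1), cubeMap_eq_iff.2 fun S hS => ?_⟩, ?_⟩, hfam.toTfiber,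
    fun x hx => ?_, fun x => ?_, fun x => ?_, fun x hx t => ?_⟩
  · exact ((hΨ ∅).map S (Finset.empty_subset S) (x, 1) 1).trans ((hΨ S).one hS x _)
  · exact Continuous.subtype_mk (by fun_prop) _
  · exact Subtype.ext (((hΨ ∅).boundary x hx 1 1).trans (push_empty _))
  · exact Tfiber.ext (((hΨ ∅).zero x 1).trans (hφ0 x 1)) fun t S w =>
      ((hΨ S.1).zero x _).trans (hφc S x t w)
  · exact Tfiber.ext rfl fun t S w => (hΨ S.1).one S.2 x _
  · rw [← hag x hx]
    exact Tfiber.ext (((hΨ ∅).boundary x hx t 1).trans (push_empty _)) fun s S w =>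
      ((hΨ S.1).boundary x hx t _).trans (hab x S.1 S.2)

end FibrantCube

/-! ### Matching fibers and strict total fibers -/

section Main

variable {X : CosimplicialObject TopCat.{u}}

theorem IsFibrant.isFibrantCube (hX : IsFibrant X) (j : ℕ) : IsFibrantCube (shriekCube X j) :=
  fun S _ _ _ _ e _ _ hDE hE l₀ hl₀ θ hθ hlθ =>
    hX.exists_box_lift_shriekCube S e hDE hE l₀ hl₀ θ hθ hlθ

theorem map_eq_iff_σ_eq {n : ℕ} {c : SimplexCategory} (hc : c.len = n) (k : Fin (n + 1))
    (f : SimplexCategory.mk (n + 1) ⟶ c)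
    (hf : ∀ p, (f.toOrderHom p).val = if p.val < k.val + 1 then p.val else p.val - 1)
    (x y : X.obj (SimplexCategory.mk (n + 1))) :
    X.map f x = X.map f y ↔ X.σ k x = X.σ k y := by
  obtain rfl : c = SimplexCategory.mk n := SimplexCategory.ext hc
  obtain rfl := eq_σ_of_val k f hf
  rfl

/-- The maps from ∅ to singletons are the codegeneracies, and the map to any nonempty S factors
through a singleton. So both maps have the same fibers although their targets differ. -/
theorem matchingMap_eq_iff {n : ℕ} (x y : X.obj (SimplexCategory.mk (n + 1))) :
    matchingMap X n x = matchingMap X n y ↔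
      cubeMap (shriekCube X (n + 1)) x = cubeMap (shriekCube X (n + 1)) y := by
  have hσ : ∀ i : Fin (n + 1), push (shriekCube X (n + 1)) (insert i ∅) x =
      push (shriekCube X (n + 1)) (insert i ∅) y ↔ X.σ i x = X.σ i y := fun i => by
    refine map_eq_iff_σ_eq (c := (cShriek (n + 1)).obj (insert i ∅)) ?_ i
      ((cShriek (n + 1)).map (homOfLE (Finset.empty_subset (insert i ∅)))) ?_ x y
    · change n + 1 - (insert i ∅ : Finset (Fin (n + 1))).card = n
      simp
    · refine cShriek_map_insert_val _ (Finset.notMem_empty i) rfl ?_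
      have : (remaining (∅ : Finset (Fin (n + 1)))).filter (· < i.succ) = Finset.Iio i.succ := by
        ext y
        simp [remaining]
      rw [this, Fin.card_Iio]
      rfl
  refine Iff.trans ?_ (cubeMap_eq_iff (F := shriekCube X (n + 1))).symm
  constructor
  · intro h S hS
    obtain ⟨i, hi⟩ := hS
    have hle : insert i ∅ ≤ S := Finset.insert_subset hi (Finset.empty_subset S)
    have h' := (hσ i).2 (congrFun (congrArg Subtype.val h) i)
    exact (map_push (F := shriekCube X (n + 1)) hle x).symm.trans
      ((congrArg _ h').trans (map_push (F := shriekCube X (n + 1)) hle y))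
  · exact fun h => Subtype.ext (funext fun i => (hσ i).1 (h _ (Finset.insert_nonempty i ∅)))

theorem Fiber.weaklyEquivalent_genLoop_cubeMap (n : ℕ) (b : X.obj (SimplexCategory.mk (n + 1))) :
    WeaklyEquivalent
      (GenLoop (Fin (n + 1)) (Fiber (matchingMap X n) (matchingMap X n b)) ⟨b, rfl⟩)
      (GenLoop (Fin (n + 1)) (Fiber (cubeMap (shriekCube X (n + 1)))
        (cubeMap (shriekCube X (n + 1)) b)) ⟨b, rfl⟩) := by
  let f : C(Fiber (matchingMap X n) (matchingMap X n b),
      Fiber (cubeMap (shriekCube X (n + 1))) (cubeMap (shriekCube X (n + 1)) b)) :=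
    ⟨fun x => ⟨x.1, (matchingMap_eq_iff _ _).1 x.2⟩, continuous_subtype_val.subtype_mk _⟩
  let g : C(Fiber (cubeMap (shriekCube X (n + 1))) (cubeMap (shriekCube X (n + 1)) b),
      Fiber (matchingMap X n) (matchingMap X n b)) :=
    ⟨fun x => ⟨x.1, (matchingMap_eq_iff _ _).2 x.2⟩, continuous_subtype_val.subtype_mk _⟩
  have hf : IsCompressing f := .of_inverse g (fun _ => rfl) fun _ => rfl
  exact (hf.loopMap (n + 1) ⟨b, rfl⟩).weaklyEquivalent

end Main

end TotLayer

end

theorem propositionP (X : CosimplicialObject TopCat.{u}) (hX : TotLayer.IsFibrant X)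
    (j : ℕ) (f : TotLayer.Tot X j) (hL : Nonempty (TotLayer.Layer X j f)) :
    TotLayer.WeaklyEquivalent
      (TotLayer.Layer X j f)
      (GenLoop (Fin (j + 1))
        (TotLayer.Tfiber (TotLayer.shriekCube X (j + 1))
          (TotLayer.shriekBase X (j + 1) f.point))
        (TotLayer.Tfiber.base (TotLayer.shriekCube X (j + 1))
          (TotLayer.shriekBase X (j + 1) f.point))) := by
  -- The base point of the cube unfolds to the image of f_0(Δ^0) under [0] → [j + 1], 0 ↦ 0, so
  -- `rfl` identifies it with the base point of the loop space.
  refine .trans _ _ _ (hX.weaklyEquivalent_layer hL rfl) ?_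
  refine .trans _ _ _ (TotLayer.Fiber.weaklyEquivalent_genLoop_cubeMap j _) ?_
  exact (((hX.isFibrantCube (j + 1)).isCompressing_fiberInclusion _).loopMap (j + 1)
    ⟨_, rfl⟩).weaklyEquivalent
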